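/- **Theorem 2.3 (Finiteness of $\mathcal E^{\Phi,p}(f)$).** Let $p\in[1,\infty)$ and $\mathcal L>0$. Let $\Phi:[0,\infty)\to[0,\infty)$ satisfy: - (A0) $\Phi(0)=0$, $\Phi$ is $C^1$ on $(0,\infty)$, and $\Phi'(x)>0$ for $x>0$. - (A1) There is $K>0$ such that $\lim_{x\to+0} \frac{x\Phi'(x)}{\Phi(x)}=K$. - (A2) There is a measurable function $\varphi:[0,\infty)\to[0,\infty)$ such that $\Phi(kx)\le\varphi(k)\Phi(x)$ for all $k,x\ge 0$, and such that $M(a):=\int_0^a\frac{\varphi(t)^p}{t}\,dt$ satisfies $M(a)<\infty$ for all $a>0$ and $M(\varepsilon)=o(\varepsilon)$ as $\varepsilon\to+0$. - (A3) $\int_0^a \frac{t^{2p}}{\Phi(t)^p}\,dt<\infty$ for all $a>0$. Set $\Psi(x):=\left(\Phi(x)/x^{1/p}\right)^{1/2}$ for $x>0$. Write $|s_2-s_1|$ for the distance in $\mathbb R/\mathcal L\mathbb Z$. For $g:\mathbb R/\mathcal L\mathbb Z\to\mathbb R^d$ put $$[g]_{\Psi,2p}:=\left(\iint_{(\mathbb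 R/\mathcal L\mathbb Z)^2}\frac{\|g(s_2)-g(s_1)\|^{2p}}{\Psi(|s_2-s_1|)^{2p}}\,\frac{1}{|s_2-s_1|}\,ds_2\,ds_1\right)^{1/(2p)},\qquad \|g\|_{W^{\Psi,2p}}:=\|g\|_{L^{2p}}+[g]_{\Psi,2p},$$ and let $W^{1+\Psi,2p}(\mathbb R/\mathcal L\mathbb Z,\mathbb R^d)$ be the set of $f\in W^{1,2p}(\mathbb R/\mathcal L\mathbb Z,\mathbb R^d)$ whose weak derivative $f'$ satisfies $[f']_{\Psi,2p}<\infty$. For an injective Lipschitz closed curve $f:\mathbb R/\mathcal L\mathbb Z\to\mathbb R^d$ parametrized by arc length (hence of total length $\mathcal L$), put $$\mathcal E^{\Phi,p}(f):=\iint_{(\mathbb R/\mathcal L\mathbb Z)^2}\left(\frac1{\Phi(\|f(s_2)-f(s_1)\|)}-\frac1{\Phi(\mathscr D(f(s_1),f(s_2)))}\right)^p ds_2\,ds_1\in[0,\infty],$$ where $\mathscr D(f(s_1),f(s_2))$ is the intrinsic distance along the curve, i.e. the length of the shorter arc of $f$ between $f(s_1)$ and $f(s_2)$. Then the following hold. 1.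 For every $d$ and every such curve $f$: if $f\in W^{1+\Psi,2p}(\mathbb R/\mathcal L\mathbb Z,\mathbb R^d)$ and $f$ is bi-Lipschitz continuous, then $\mathcal E^{\Phi,p}(f)<\infty$. 2. There is a constant $C>0$, depending only on $p$, $\mathcal L$ and $\Phi$, such that for every $d$ and every such curve $f$: if $\mathcal E^{\Phi,p}(f)<\infty$, then $f\in W^{1+\Psi,2p}(\mathbb R/\mathcal L\mathbb Z,\mathbb R^d)$ and $$\|f'\|_{W^{\Psi,2p}}^{2p}\le C\left(\mathcal E^{\Phi,p}(f)+\|f'\|_{L^{2p}}\right).$$ -/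

import Mathlib

open Set Filter MeasureTheory
open scoped Topology ENNReal NNReal

noncomputable section

namespace OHara

/-- The `ℓ`-periodic lift to `ℝ` of a map defined on `ℝ/ℓℤ`. -/
def lift {ℓ : ℝ} {E : Type*} (f : AddCircle ℓ → E) : ℝ → E :=
  fun t => f (t : AddCircle ℓ)

/-- The intrinsic distance along the closed curve `f` between the points with parameters `x` and
`y`: the least length of an arc of the curve joining them. The arcs are the restrictions of the
periodic lift of `f` to the intervals between a representative of `x` and one of `y`. -/
def intrinsicDist {ℓ : ℝ} {E : Type*} [PseudoEMetricSpace E] (f : AddCircle ℓ → E)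
    (x y : AddCircle ℓ) : ℝ≥0∞ :=
  ⨅ (a : ℝ) (b : ℝ) (_ : (a : AddCircle ℓ) = x) (_ : (b : AddCircle ℓ) = y),
    eVariationOn (lift f) (uIcc a b)

/-- `f : ℝ/ℓℤ → E` is a Lipschitz embedded closed curve parametrized by arc length: the length of
the arc between the parameters `a ≤ b` is `b - a` (so its total length is `ℓ`). -/
structure IsArcLengthClosedCurve {ℓ : ℝ} {E : Type*} [NormedAddCommGroup E]
    (f : AddCircle ℓ → E) [Fact (0 < ℓ)] : Prop where
  lipschitz : ∃ K : ℝ≥0, LipschitzWith K f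
  injective : Function.Injective f
  unitSpeed : HasUnitSpeedOn (lift f) univ

/-- Bi-Lipschitz continuity with respect to the distance of `ℝ/ℓℤ`. -/
def IsBiLipschitz {X E : Type*} [PseudoEMetricSpace X] [PseudoEMetricSpace E]
    (f : X → E) : Prop :=
  (∃ K : ℝ≥0, LipschitzWith K f) ∧ ∃ K : ℝ≥0, AntilipschitzWith K f

/-- The generalized O'Hara energy
`∬ (1 / Φ(‖f s₂ - f s₁‖) - 1 / Φ(D(f s₁, f s₂))) ^ p ds₂ ds₁`, with values in `[0, ∞]`. -/
def energy {ℓ : ℝ} [Fact (0 < ℓ)] {E : Type*} [NormedAddCommGroup E]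
    (Φ : ℝ → ℝ) (p : ℝ) (f : AddCircle ℓ → E) : ℝ≥0∞ :=
  ∫⁻ s₁ : AddCircle ℓ, ∫⁻ s₂ : AddCircle ℓ,
    ((ENNReal.ofReal (Φ ‖f s₂ - f s₁‖))⁻¹
      - (ENNReal.ofReal (Φ (intrinsicDist f s₁ s₂).toReal))⁻¹) ^ p

/-- The seminorm `[g]_{Ψ,q} = (∬ ‖g s₂ - g s₁‖^q / Ψ(|s₂ - s₁|)^q · 1/|s₂ - s₁| ds₂ ds₁)^(1/q)`
on `ℝ/ℓℤ`, where `|s₂ - s₁|` is the distance in `ℝ/ℓℤ`. -/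
def seminorm {ℓ : ℝ} [Fact (0 < ℓ)] {E : Type*} [NormedAddCommGroup E]
    (Ψ : ℝ → ℝ) (q : ℝ) (g : AddCircle ℓ → E) : ℝ≥0∞ :=
  (∫⁻ s₁ : AddCircle ℓ, ∫⁻ s₂ : AddCircle ℓ,
    ‖g s₂ - g s₁‖ₑ ^ q / ENNReal.ofReal (Ψ ‖s₂ - s₁‖) ^ q / ‖s₂ - s₁‖ₑ) ^ (1 / q)

/-- The norm `‖g‖_{W^{Ψ,q}} = ‖g‖_{L^q} + [g]_{Ψ,q}`. -/
def wNorm {ℓ : ℝ} [Fact (0 < ℓ)] {E : Type*} [NormedAddCommGroup E]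
    (Ψ : ℝ → ℝ) (q : ℝ) (g : AddCircle ℓ → E) : ℝ≥0∞ :=
  eLpNorm g (ENNReal.ofReal q) volume + seminorm Ψ q g

/-- `g` is the weak derivative of `f` on `ℝ/ℓℤ`; the test functions are the smooth `ℓ`-periodic
functions on `ℝ`. -/
def IsWeakDeriv {ℓ : ℝ} [Fact (0 < ℓ)] {E : Type*} [NormedAddCommGroup E] [NormedSpace ℝ E]
    (f g : AddCircle ℓ → E) : Prop :=
  Integrable f volume ∧ Integrable g volume ∧
    ∀ η : ℝ → ℝ, ContDiff ℝ ((⊤ : ℕ∞) : WithTop ℕ∞) η → Function.Periodic η ℓ →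
      ∫ t in (0 : ℝ)..ℓ, deriv η t • lift f t = -∫ t in (0 : ℝ)..ℓ, η t • lift g t

/-- Membership in `W^{1+Ψ,q}(ℝ/ℓℤ, E)`: `f` lies in `W^{1,q}` and `[f']_{Ψ,q} < ∞`. -/
def MemW {ℓ : ℝ} [Fact (0 < ℓ)] {E : Type*} [NormedAddCommGroup E] [NormedSpace ℝ E]
    (Ψ : ℝ → ℝ) (q : ℝ) (f : AddCircle ℓ → E) : Prop :=
  MemLp f (ENNReal.ofReal q) volume ∧
    ∃ g : AddCircle ℓ → E, IsWeakDeriv f g ∧ MemLp g (ENNReal.ofReal q) volume ∧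
      seminorm Ψ q g < ⊤

/-- `M(a) = ∫₀ᵃ φ(t)^p / t dt`, with values in `[0, ∞]`. -/
def scalingIntegral (φ : ℝ → ℝ) (p a : ℝ) : ℝ≥0∞ :=
  ∫⁻ t in Ioc 0 a, ENNReal.ofReal (φ t ^ p / t)

/-- The hypotheses on `Φ : [0, ∞) → [0, ∞)` (only its values on `[0, ∞)` matter). -/
structure IsAdmissible (Φ : ℝ → ℝ) (p : ℝ) : Prop where
  nonneg : ∀ x, 0 ≤ x → 0 ≤ Φ x
  map_zero : Φ 0 = 0
  contDiffOn : ContDiffOn ℝ 1 Φ (Ioi 0)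
  deriv_pos : ∀ x, 0 < x → 0 < deriv Φ x
  tendsto_G : ∃ K : ℝ, 0 < K ∧ Tendsto (fun x => x * deriv Φ x / Φ x) (𝓝[>] 0) (𝓝 K)
  scaling : ∃ φ : ℝ → ℝ, Measurable φ ∧ (∀ k, 0 ≤ k → 0 ≤ φ k) ∧
    (∀ k x, 0 ≤ k → 0 ≤ x → Φ (k * x) ≤ φ k * Φ x) ∧
    Tendsto (fun ε : ℝ => scalingIntegral φ p ε / ENNReal.ofReal ε) (𝓝[>] 0) (𝓝 0) ∧
    ∀ a, 0 < a → scalingIntegral φ p a < ⊤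
  integral_lt_top : ∀ a, 0 < a →
    ∫⁻ t in Ioc 0 a, ENNReal.ofReal (t ^ (2 * p) / Φ t ^ p) < ⊤

/-- `Ψ(x) = (Φ(x) / x^(1/p))^(1/2)`. -/
def psi (Φ : ℝ → ℝ) (p : ℝ) (x : ℝ) : ℝ :=
  (Φ x / x ^ (1 / p)) ^ (1 / 2 : ℝ)

end OHara

end

/-!
Since `Ψ(x) ^ (2p) * x = Φ(x) ^ p`, the `2p`-th power of the seminorm `[g]_{Ψ,2p}` is the integral
`∫ ω(h) Φ(|h|)^(-p) dh` over `|h| ≤ ℓ / 2`, where `ω(h) = ∫ ‖g(s + h) - g(s)‖^(2p) ds`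
(`seminorm_rpow_eq_gagliardo`). For a curve parametrized by arc length the intrinsic distance of
`f(s + h)` and `f(s)` is `|h|`. The mean value theorem for `1 / Φ`, together with the bounds on
`x Φ'(x) / Φ(x)`, shows that the integrand of the energy is comparable to `(δ / Φ(|h|)) ^ p` with
the defect `δ = 1 - ‖f(s + h) - f(s)‖ / |h|`; only the upper bound uses the bi-Lipschitz condition
(`exists_energy_le_defectEnergy`, `exists_defectEnergy_le_energy`). The scaling hypothesis on `Φ`
enters through the change of variables
`∫ ω(w h) Φ(|h|)^(-p) dh ≤ φ(w)^p / w * ∫ ω(h) Φ(|h|)^(-p) dh` for `0 < w ≤ 1`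
(`lintegral_comp_mul_kernel_le`).

*Regularity implies finite energy.* The tangent `f'` is a unit vector almost everywhere, and testing
the chord against `f'(s)` gives `δ ≤ ∫₀¹ ‖f'(s + u h) - f'(s)‖² du` (`defect_le_lintegral`).
Jensen's inequality and the scaling bound turn this into a bound of the energy by
`M(1) [f']^(2p)`, up to a constant.

*Finite energy implies regularity.* If `δ` is small, the mean tangents over the first and the last
`ε`-fraction of the arc both have to be close to the direction of the chord, so that their
difference is at most `(8 δ / ε)^(1/2)` (`norm_endDiff_sq_le`). Comparing `f'(s + h)` and `f'(s)`
with these mean tangents bounds `[f']^(2p)` by `M(ε) / ε * [f']^(2p)` plus the energy, with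
constants, and for small `ε` the first term can be absorbed because `M(ε) = o(ε)`. The absorption
needs finiteness beforehand. It is therefore carried out for the difference quotients
`(f(s + ν) - f(s)) / ν`, which are Lipschitz and so have finite seminorm by the integrability of
`t^(2p) / Φ(t)^p`; the same mean tangents appear, averaged over translates by at most `ν`
(`diffQuot_sub_eq`). The resulting bound is uniform in `ν`, and Fatou's lemma gives it for `f'`
(`gagliardo_velocity_le`). Uniqueness of the weak derivative (`IsWeakDeriv.ae_eq`) transfers
everything from the classical to any weak derivative.
-/

noncomputable section

namespace OHara


/-! ### The growth of `Φ` -/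

section Growth

variable {Φ : ℝ → ℝ} {p : ℝ}

theorem IsAdmissible.differentiableAt (hΦ : IsAdmissible Φ p) {x : ℝ} (hx : 0 < x) :
    DifferentiableAt ℝ Φ x :=
  (hΦ.contDiffOn.differentiableOn (by norm_num)).differentiableAt (Ioi_mem_nhds hx)

theorem IsAdmissible.strictMonoOn_Ioi (hΦ : IsAdmissible Φ p) : StrictMonoOn Φ (Ioi 0) := by
  refine strictMonoOn_of_deriv_pos (convex_Ioi 0) hΦ.contDiffOn.continuousOn fun x hx => ?_
  rw [interior_Ioi] at hx
  exact hΦ.deriv_pos x hx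

theorem IsAdmissible.pos (hΦ : IsAdmissible Φ p) {x : ℝ} (hx : 0 < x) : 0 < Φ x :=
  (hΦ.nonneg (x / 2) (by positivity)).trans_lt
    (hΦ.strictMonoOn_Ioi (half_pos hx) hx (half_lt_self hx))

theorem IsAdmissible.monotoneOn (hΦ : IsAdmissible Φ p) : MonotoneOn Φ (Ici 0) := by
  intro x hx y hy hxy
  rcases eq_or_lt_of_le (mem_Ici.1 hx) with rfl | hx
  · rw [hΦ.map_zero]; exact hΦ.nonneg y hy
  · exact hΦ.strictMonoOn_Ioi.monotoneOn hx (lt_of_lt_of_le hx hxy) hxy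

theorem IsAdmissible.measurable_comp_abs (hΦ : IsAdmissible Φ p) :
    Measurable fun x : ℝ => Φ |x| := by
  have h : Monotone fun x : ℝ => Φ (max x 0) := fun x y hxy =>
    hΦ.monotoneOn (le_max_right x 0) (le_max_right y 0) (max_le_max_right 0 hxy)
  have h' : (fun x : ℝ => Φ |x|) = (fun x : ℝ => Φ (max x 0)) ∘ fun x => |x| := by
    ext x; simp
  rw [h']
  exact h.measurable.comp measurable_norm

/-- The logarithmic derivative `x Φ' / Φ` is bounded above and below on bounded intervals:
near `0` by its limit, away from `0` by compactness. -/
theorem IsAdmissible.exists_logDeriv_bounds (hΦ : IsAdmissible Φ p) (L : ℝ) :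
    ∃ κ K : ℝ, 0 < κ ∧ 0 < K ∧ ∀ x, 0 < x → x ≤ L →
      κ * Φ x ≤ x * deriv Φ x ∧ x * deriv Φ x ≤ K * Φ x := by
  obtain ⟨K, hK, hlim⟩ := hΦ.tendsto_G
  have hnear := hlim.eventually (Ioo_mem_nhds (half_lt_self hK) (lt_two_mul_self hK))
  obtain ⟨δ, hδ, hδ'⟩ := mem_nhdsGT_iff_exists_Ioo_subset.1 hnear
  have hδ : 0 < δ := hδ
  have hδ' : ∀ x, 0 < x → x < δ → x * deriv Φ x / Φ x ∈ Ioo (K / 2) (2 * K) :=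
    fun x h1 h2 => hδ' ⟨h1, h2⟩
  have hcont : ContinuousOn (fun x => x * deriv Φ x / Φ x) (Icc δ (max δ L)) := by
    have hs : Icc δ (max δ L) ⊆ Ioi 0 := fun x hx => lt_of_lt_of_le hδ hx.1
    refine (continuousOn_id.mul ?_).div (hΦ.contDiffOn.continuousOn.mono hs)
      fun x hx => (hΦ.pos (hs hx)).ne'
    exact (hΦ.contDiffOn.continuousOn_deriv_of_isOpen isOpen_Ioi le_rfl).mono hs
  have hne : (Icc δ (max δ L)).Nonempty := ⟨δ, le_rfl, le_max_left _ _⟩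
  obtain ⟨a, ha, hamin⟩ := isCompact_Icc.exists_isMinOn hne hcont
  obtain ⟨b, hb, hbmax⟩ := isCompact_Icc.exists_isMaxOn hne hcont
  have hpos : ∀ x, 0 < x → 0 < x * deriv Φ x / Φ x := fun x hx =>
    div_pos (mul_pos hx (hΦ.deriv_pos x hx)) (hΦ.pos hx)
  -- `K / 2` and `2 * K` serve near `0`, the extrema `a` and `b` on the compact remainder.
  refine ⟨min (K / 2) (a * deriv Φ a / Φ a), max (2 * K) (b * deriv Φ b / Φ b),
    lt_min (half_pos hK) (hpos a (hδ.trans_le ha.1)), lt_max_of_lt_left (by positivity), ?_⟩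
  intro x hx hxL
  rw [← le_div_iff₀ (hΦ.pos hx), ← div_le_iff₀ (hΦ.pos hx)]
  rcases lt_or_ge x δ with h | h
  · have := hδ' x hx h
    exact ⟨(min_le_left _ _).trans this.1.le, this.2.le.trans (le_max_left _ _)⟩
  · have hxm : x ∈ Icc δ (max δ L) := ⟨h, hxL.trans (le_max_right _ _)⟩
    exact ⟨(min_le_right _ _).trans (hamin hxm), (hbmax hxm).trans (le_max_right _ _)⟩

/-- The mean value theorem for `1 / Φ`. -/
theorem IsAdmissible.exists_inv_sub_inv_eq (hΦ : IsAdmissible Φ p) {r x : ℝ} (hr : 0 < r)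
    (hrx : r < x) :
    ∃ ξ ∈ Ioo r x, (Φ r)⁻¹ - (Φ x)⁻¹ = (x - r) * (deriv Φ ξ / Φ ξ ^ 2) := by
  have hd : ∀ y, 0 < y → HasDerivAt (fun z => (Φ z)⁻¹) (-deriv Φ y / Φ y ^ 2) y := fun y hy =>
    (hΦ.differentiableAt hy).hasDerivAt.fun_inv (hΦ.pos hy).ne'
  obtain ⟨ξ, hξ, h⟩ := exists_hasDerivAt_eq_slope (fun z => (Φ z)⁻¹)
    (fun y => -deriv Φ y / Φ y ^ 2) hrx
    (fun y hy => (hd y (hr.trans_le hy.1)).continuousAt.continuousWithinAt)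
    (fun y hy => hd y (hr.trans hy.1))
  refine ⟨ξ, hξ, ?_⟩
  have : x - r ≠ 0 := (sub_pos.2 hrx).ne'
  rw [eq_div_iff this] at h
  linear_combination h

/-- Lower bound for the integrand of the energy by the defect `1 - r / x`. -/
theorem IsAdmissible.exists_le_inv_sub_inv (hΦ : IsAdmissible Φ p) (L : ℝ) :
    ∃ κ : ℝ, 0 < κ ∧ ∀ r x, 0 < r → r ≤ x → x ≤ L →
      κ * (1 - r / x) * (Φ x)⁻¹ ≤ (Φ r)⁻¹ - (Φ x)⁻¹ := by
  obtain ⟨κ, K, hκ, -, hb⟩ := hΦ.exists_logDeriv_bounds L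
  refine ⟨κ, hκ, fun r x hr hrx hxL => ?_⟩
  rcases eq_or_lt_of_le hrx with rfl | hrx
  · simp [hr.ne']
  obtain ⟨ξ, hξ, h⟩ := hΦ.exists_inv_sub_inv_eq hr hrx
  have hx := hr.trans hrx
  have hξ0 : 0 < ξ := hr.trans hξ.1
  have h1 := (hb ξ hξ0 (hξ.2.le.trans hxL)).1
  have hΦξ := hΦ.pos hξ0
  have hΦx := hΦ.pos hx
  have hle : Φ ξ ≤ Φ x := hΦ.monotoneOn hξ0.le hx.le hξ.2.le
  have key : κ / (x * Φ x) ≤ deriv Φ ξ / Φ ξ ^ 2 := by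
    calc κ / (x * Φ x) ≤ κ / (ξ * Φ ξ) := by
          have := hξ.2.le
          gcongr
      _ ≤ deriv Φ ξ / Φ ξ ^ 2 := by
          rw [div_le_div_iff₀ (by positivity) (by positivity)]
          nlinarith
  rw [h]
  calc κ * (1 - r / x) * (Φ x)⁻¹ = (x - r) * (κ / (x * Φ x)) := by field_simp
    _ ≤ _ := mul_le_mul_of_nonneg_left key (sub_pos.2 hrx).le

/-- Upper bound for the integrand of the energy by the defect `1 - r / x`, valid as long as `r` and
`x` are comparable. -/
theorem IsAdmissible.exists_inv_sub_inv_le (hΦ : IsAdmissible Φ p) (L c : ℝ) (hc : 0 < c) :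
    ∃ A : ℝ, 0 ≤ A ∧ ∀ r x, 0 < r → r ≤ x → x ≤ L → x ≤ c * r →
      (Φ r)⁻¹ - (Φ x)⁻¹ ≤ A * (1 - r / x) * (Φ x)⁻¹ := by
  obtain ⟨κ, K, -, hK, hb⟩ := hΦ.exists_logDeriv_bounds L
  obtain ⟨φ, -, hφ, hscale, -⟩ := hΦ.scaling
  refine ⟨K * c * φ c, by have := hφ c hc.le; positivity, fun r x hr hrx hxL hxc => ?_⟩
  rcases eq_or_lt_of_le hrx with rfl | hrx
  · simp [hr.ne']
  obtain ⟨ξ, hξ, h⟩ := hΦ.exists_inv_sub_inv_eq hr hrx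
  have hx := hr.trans hrx
  have hξ0 : 0 < ξ := hr.trans hξ.1
  have h1 := (hb ξ hξ0 (hξ.2.le.trans hxL)).2
  have hΦξ := hΦ.pos hξ0
  have hΦx := hΦ.pos hx
  have hxξ : x ≤ c * ξ := hxc.trans (mul_le_mul_of_nonneg_left hξ.1.le hc.le)
  have hle : Φ x ≤ φ c * Φ ξ :=
    (hΦ.monotoneOn hx.le (mul_pos hc hξ0).le hxξ).trans (hscale c ξ hc.le hξ0.le)
  have key : deriv Φ ξ / Φ ξ ^ 2 ≤ K * c * φ c / (x * Φ x) := by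
    calc deriv Φ ξ / Φ ξ ^ 2 ≤ K / (ξ * Φ ξ) := by
          rw [div_le_div_iff₀ (by positivity) (by positivity)]
          nlinarith
      _ ≤ K * c * φ c / (x * Φ x) := by
          rw [div_le_div_iff₀ (by positivity) (by positivity)]
          have := mul_le_mul hxξ hle hΦx.le (by positivity)
          calc K * (x * Φ x) ≤ K * (c * ξ * (φ c * Φ ξ)) := by gcongr
            _ = _ := by ring
  rw [h]
  calc _ ≤ (x - r) * (K * c * φ c / (x * Φ x)) := mul_le_mul_of_nonneg_left key (sub_pos.2 hrx).le
    _ = _ := by field_simp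

end Growth


/-! ### Scaling of the kernel -/

/-- Jensen's inequality for the lower integral. -/
theorem rpow_lintegral_le {α : Type*} [MeasurableSpace α] {μ : Measure α}
    [IsProbabilityMeasure μ] {p : ℝ} (hp : 1 ≤ p) {f : α → ℝ≥0∞} (hf : AEMeasurable f μ) :
    (∫⁻ x, f x ∂μ) ^ p ≤ ∫⁻ x, f x ^ p ∂μ := by
  have hp0 : 0 < p := by linarith
  have h := eLpNorm'_le_eLpNorm'_of_exponent_le one_pos hp μ hf.aestronglyMeasurable
  simp only [eLpNorm', enorm_eq_self, ENNReal.rpow_one, div_one] at h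
  calc _ ≤ ((∫⁻ x, f x ^ p ∂μ) ^ (1 / p)) ^ p := ENNReal.rpow_le_rpow h hp0.le
    _ = _ := by rw [← ENNReal.rpow_mul, one_div_mul_cancel hp0.ne', ENNReal.rpow_one]

theorem lintegral_comp_mul_left_of_pos {G : ℝ → ℝ≥0∞} (hG : Measurable G) {w : ℝ} (hw : 0 < w) :
    ∫⁻ x, G (w * x) = ENNReal.ofReal w⁻¹ * ∫⁻ x, G x := by
  rw [← lintegral_map hG (measurable_const_mul w), Real.map_volume_mul_left hw.ne',
    lintegral_smul_measure, abs_of_pos (inv_pos.2 hw), smul_eq_mul]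

/-- The kernel `Φ(|h|)^(-p)`, cut off to the fundamental domain `(-L, L]` of the circle of
length `2 L`. -/
def kernel (Φ : ℝ → ℝ) (p L : ℝ) : ℝ → ℝ≥0∞ :=
  (Ioc (-L) L).indicator fun h => (ENNReal.ofReal (Φ |h|))⁻¹ ^ p

section Kernel

variable {Φ : ℝ → ℝ} {p L : ℝ}

theorem measurable_kernel (hΦ : IsAdmissible Φ p) : Measurable (kernel Φ p L) :=
  ((hΦ.measurable_comp_abs.ennreal_ofReal.inv).pow_const p).indicator measurableSet_Ioc

theorem lintegral_mul_kernel (G : ℝ → ℝ≥0∞) :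
    ∫⁻ h, G h * kernel Φ p L h =
      ∫⁻ h in Ioc (-L) L, G h * (ENNReal.ofReal (Φ |h|))⁻¹ ^ p := by
  rw [← lintegral_indicator measurableSet_Ioc]
  refine lintegral_congr fun h => ?_
  by_cases hh : h ∈ Ioc (-L) L <;> simp [kernel, hh]

/-- The kernel inherits the scaling of `Φ`. At `h = 0` both sides are infinite. -/
theorem kernel_div_le (hΦ : IsAdmissible Φ p) (hp : 0 ≤ p) {φ : ℝ → ℝ}
    (hscale : ∀ k x, 0 ≤ k → 0 ≤ x → Φ (k * x) ≤ φ k * Φ x) {w : ℝ} (hw : 0 < w) (hw1 : w ≤ 1)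
    (h : ℝ) : kernel Φ p L (h / w) ≤ ENNReal.ofReal (φ w) ^ p * kernel Φ p L h := by
  have hφw : 0 < φ w := by
    have h1 := hscale w 1 hw.le zero_le_one
    have h2 := hΦ.pos (mul_pos hw one_pos)
    have h3 := hΦ.pos one_pos
    by_contra! h4
    nlinarith
  by_cases hh : h / w ∈ Ioc (-L) L
  · have hmem : h ∈ Ioc (-L) L := by
      have h1 := hh.1
      have h2 := hh.2
      rw [lt_div_iff₀ hw] at h1
      rw [div_le_iff₀ hw] at h2
      have hL : 0 < L := by
        have := hh.1.trans_le hh.2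
        linarith
      exact ⟨by nlinarith, by nlinarith⟩
    simp only [kernel, indicator_of_mem hh, indicator_of_mem hmem]
    rw [← ENNReal.mul_rpow_of_nonneg _ _ hp]
    refine ENNReal.rpow_le_rpow ?_ hp
    have h1 := hscale w |h / w| hw.le (abs_nonneg _)
    rw [abs_div, abs_of_pos hw, mul_div_cancel₀ _ hw.ne'] at h1
    have h2 : ENNReal.ofReal (Φ |h|) ≤ ENNReal.ofReal (φ w) * ENNReal.ofReal (Φ (|h| / w)) := by
      rw [← ENNReal.ofReal_mul hφw.le]
      exact ENNReal.ofReal_le_ofReal h1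
    have h3 : ENNReal.ofReal (φ w) ≠ 0 := by simpa using hφw
    rw [abs_div, abs_of_pos hw]
    calc _ = ENNReal.ofReal (φ w) *
          (ENNReal.ofReal (φ w) * ENNReal.ofReal (Φ (|h| / w)))⁻¹ := by
          rw [ENNReal.mul_inv (Or.inl h3) (Or.inl ENNReal.ofReal_ne_top), ← mul_assoc,
            ENNReal.mul_inv_cancel h3 ENNReal.ofReal_ne_top, one_mul]
      _ ≤ _ := by gcongr
  · simp [kernel, hh]

/-- Rescaling an increment `h` to `w h` costs the factor `φ(w)^p / w`. -/
theorem lintegral_comp_mul_kernel_le (hΦ : IsAdmissible Φ p) (hp : 0 ≤ p) {φ : ℝ → ℝ}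
    (hφ : ∀ k, 0 ≤ k → 0 ≤ φ k)
    (hscale : ∀ k x, 0 ≤ k → 0 ≤ x → Φ (k * x) ≤ φ k * Φ x) {w : ℝ} (hw : 0 < w) (hw1 : w ≤ 1)
    {ω : ℝ → ℝ≥0∞} (hω : Measurable ω) :
    ∫⁻ h, ω (w * h) * kernel Φ p L h ≤
      ENNReal.ofReal (φ w ^ p / w) * ∫⁻ h, ω h * kernel Φ p L h := by
  have hK := measurable_kernel (L := L) hΦ
  have h1 : ∫⁻ h, ω (w * h) * kernel Φ p L h = ∫⁻ h, ω (w * h) * kernel Φ p L (w * h / w) :=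
    lintegral_congr fun h => by rw [mul_div_cancel_left₀ _ hw.ne']
  rw [h1, lintegral_comp_mul_left_of_pos (G := fun x => ω x * kernel Φ p L (x / w))
    (hω.mul (hK.comp (measurable_id.div_const w))) hw]
  calc _ ≤ ENNReal.ofReal w⁻¹ *
        ∫⁻ x, ω x * (ENNReal.ofReal (φ w) ^ p * kernel Φ p L x) := by
        gcongr with x
        exact kernel_div_le hΦ hp hscale hw hw1 x
    _ = ENNReal.ofReal w⁻¹ * (ENNReal.ofReal (φ w) ^ p * ∫⁻ x, ω x * kernel Φ p L x) := by
        rw [← lintegral_const_mul (f := fun x => ω x * kernel Φ p L x) _ (hω.mul hK)]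
        congr 1
        exact lintegral_congr fun x => by ring
    _ = _ := by
        rw [← mul_assoc, ENNReal.ofReal_rpow_of_nonneg (hφ w hw.le) hp,
          ← ENNReal.ofReal_mul (inv_pos.2 hw).le, inv_mul_eq_div]

end Kernel

/-! ### Double integrals over the circle -/

section Circle

variable {ℓ : ℝ} [hℓ : Fact (0 < ℓ)]

theorem norm_coe_of_mem_Ioc {h : ℝ} (hh : h ∈ Ioc (-(ℓ / 2)) (ℓ / 2)) :
    ‖(h : AddCircle ℓ)‖ = |h| := by
  rw [AddCircle.norm_coe_eq_abs_iff ℓ hℓ.out.ne', abs_of_pos hℓ.out]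
  exact abs_le.2 ⟨hh.1.le, hh.2⟩

theorem lintegral_eq_lintegral_add_coe (G : AddCircle ℓ → ℝ≥0∞) (s : AddCircle ℓ) :
    ∫⁻ x, G x = ∫⁻ h in Ioc (-(ℓ / 2)) (ℓ / 2), G (s + (h : ℝ)) := by
  rw [← lintegral_add_left_eq_self G s, ← AddCircle.lintegral_preimage ℓ (-(ℓ / 2))]
  congr 3
  ring

variable {E : Type*} [NormedAddCommGroup E]

/-- The `q`-th power of the `L^q` norm of the increment `g(· + h) - g`. -/
def increment (q : ℝ) (g : AddCircle ℓ → E) (h : ℝ) : ℝ≥0∞ :=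
  ∫⁻ s : AddCircle ℓ, ‖g (s + (h : ℝ)) - g s‖ₑ ^ q

/-- The `2p`-th power of the seminorm `[g]_{Ψ,2p}`: since `Ψ(x)^(2p) x = Φ(x)^p`, it is the
integral of the increments of `g` against the kernel `Φ(|h|)^(-p)`. -/
def gagliardo (Φ : ℝ → ℝ) (p : ℝ) (g : AddCircle ℓ → E) : ℝ≥0∞ :=
  ∫⁻ h, increment (2 * p) g h * kernel Φ p (ℓ / 2) h

theorem enorm_rpow_div_psi {Φ : ℝ → ℝ} {p : ℝ} (hΦ : IsAdmissible Φ p) (hp : 1 ≤ p) (v : E)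
    (x : ℝ) (hx : 0 ≤ x) (hv : x = 0 → v = 0) :
    ‖v‖ₑ ^ (2 * p) / ENNReal.ofReal (psi Φ p x) ^ (2 * p) / ENNReal.ofReal x =
      ‖v‖ₑ ^ (2 * p) * (ENNReal.ofReal (Φ x))⁻¹ ^ p := by
  have hp0 : 0 < p := by linarith
  rcases eq_or_lt_of_le hx with rfl | hx
  · rw [hv rfl]
    have : 0 < 2 * p := by positivity
    simp [this]
  have hΦx := hΦ.pos hx
  have h1 : ENNReal.ofReal (psi Φ p x) ^ (2 * p) = ENNReal.ofReal (Φ x ^ p / x) := by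
    have h0 : 0 ≤ Φ x / x ^ (1 / p) := by positivity
    rw [psi, ENNReal.ofReal_rpow_of_nonneg (by positivity) (by positivity), ← Real.rpow_mul h0]
    congr 1
    rw [show (1 / 2 : ℝ) * (2 * p) = p by ring, Real.div_rpow hΦx.le (by positivity),
      ← Real.rpow_mul hx.le, one_div_mul_cancel hp0.ne', Real.rpow_one]
  rw [h1, div_eq_mul_inv, div_eq_mul_inv, mul_assoc, ← ENNReal.mul_inv (Or.inr (by simp))
    (Or.inl (by simp)), ← ENNReal.ofReal_mul (by positivity), div_mul_cancel₀ _ hx.ne',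
    ENNReal.inv_rpow, ENNReal.ofReal_rpow_of_nonneg hΦx.le hp0.le]

theorem seminorm_congr_ae {Ψ : ℝ → ℝ} {q : ℝ} {g g' : AddCircle ℓ → E} (h : g =ᵐ[volume] g') :
    seminorm Ψ q g = seminorm Ψ q g' := by
  rw [seminorm, seminorm]
  congr 1
  refine lintegral_congr_ae ?_
  filter_upwards [h] with s₁ h₁
  refine lintegral_congr_ae ?_
  filter_upwards [h] with s₂ h₂
  rw [h₁, h₂]

variable [MeasurableSpace E] [BorelSpace E] [SecondCountableTopology E]

omit hℓ in
theorem measurable_increment_integrand {q : ℝ} {g : AddCircle ℓ → E} (hg : Measurable g) :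
    Measurable fun z : AddCircle ℓ × ℝ => ‖g (z.1 + (z.2 : ℝ)) - g z.1‖ₑ ^ q := by
  have h1 : Measurable fun z : AddCircle ℓ × ℝ => z.1 + ((z.2 : ℝ) : AddCircle ℓ) :=
    measurable_fst.add (AddCircle.measurable_mk'.comp measurable_snd)
  exact (((hg.comp h1).sub (hg.comp measurable_fst)).enorm).pow_const q

theorem measurable_increment {q : ℝ} {g : AddCircle ℓ → E} (hg : Measurable g) :
    Measurable (increment q g) :=
  (measurable_increment_integrand hg).lintegral_prod_left'

theorem seminorm_rpow_eq_gagliardo {Φ : ℝ → ℝ} {p : ℝ} (hΦ : IsAdmissible Φ p) (hp : 1 ≤ p)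
    {g : AddCircle ℓ → E} (hg : Measurable g) :
    seminorm (psi Φ p) (2 * p) g ^ (2 * p) = gagliardo Φ p g := by
  have hp0 : 0 < 2 * p := by linarith
  rw [seminorm, ← ENNReal.rpow_mul, one_div_mul_cancel hp0.ne', ENNReal.rpow_one]
  calc _ = ∫⁻ s₁ : AddCircle ℓ, ∫⁻ h : ℝ,
        ‖g (s₁ + (h : ℝ)) - g s₁‖ₑ ^ (2 * p) * kernel Φ p (ℓ / 2) h := by
        refine lintegral_congr fun s₁ => ?_
        rw [lintegral_eq_lintegral_add_coe _ s₁, lintegral_mul_kernel]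
        refine setLIntegral_congr_fun measurableSet_Ioc fun h hh => ?_
        simp only [add_sub_cancel_left]
        rw [← norm_coe_of_mem_Ioc hh, ← enorm_rpow_div_psi hΦ hp _ _ (norm_nonneg _),
          ofReal_norm]
        intro h0
        rw [norm_eq_zero] at h0
        simp [h0]
    _ = _ := by
        rw [lintegral_lintegral_swap]
        · refine lintegral_congr fun h => ?_
          rw [lintegral_mul_const]
          · rfl
          · exact (measurable_increment_integrand hg).comp (measurable_id.prodMk measurable_const)
        · exact ((measurable_increment_integrand hg).mul
            ((measurable_kernel hΦ).comp measurable_snd)).aemeasurable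

end Circle


/-! ### Lipschitz curves on the line -/

section Line

variable {E : Type*} [NormedAddCommGroup E] [InnerProductSpace ℝ E] {F : ℝ → E} {K : ℝ≥0}

theorem absolutelyContinuousOnInterval_inner (hF : LipschitzWith K F) (e : E) (a b : ℝ) :
    AbsolutelyContinuousOnInterval (fun t => inner ℝ e (F t)) a b :=
  ((innerSL ℝ e).lipschitz.comp hF).lipschitzOnWith.absolutelyContinuousOnInterval

variable [FiniteDimensional ℝ E]

theorem ae_deriv_inner_eq (hF : LipschitzWith K F) (e : E) :
    ∀ᵐ t, deriv (fun t => inner ℝ e (F t)) t = inner ℝ e (deriv F t) := by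
  filter_upwards [hF.ae_differentiableAt_real] with t ht
  exact ((innerSL ℝ e).hasFDerivAt.comp_hasDerivAt t ht.hasDerivAt).deriv

theorem intervalIntegrable_deriv (hF : LipschitzWith K F) (a b : ℝ) :
    IntervalIntegrable (deriv F) volume a b := by
  refine (intervalIntegrable_const (c := (K : ℝ))).mono_fun (aestronglyMeasurable_deriv F _) ?_
  exact Eventually.of_forall fun t => by
    simpa using norm_deriv_le_of_lipschitz hF

/-- The fundamental theorem of calculus for Lipschitz curves. -/
theorem integral_deriv_eq_sub_of_lipschitzWith (hF : LipschitzWith K F) (a b : ℝ) :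
    ∫ t in a..b, deriv F t = F b - F a := by
  refine ext_inner_left ℝ fun e => ?_
  have h1 := (absolutelyContinuousOnInterval_inner hF e a b).integral_deriv_eq_sub
  have h2 := (innerSL ℝ e).intervalIntegral_comp_comm (intervalIntegrable_deriv hF a b)
  simp only [innerSL_apply_apply] at h2
  rw [inner_sub_right, ← h1, ← h2]
  refine intervalIntegral.integral_congr_ae ?_
  filter_upwards [ae_deriv_inner_eq hF e] with t ht _ using ht.symm

/-- Integration by parts for Lipschitz curves. -/
theorem integral_deriv_smul_eq_sub (hF : LipschitzWith K F) {η : ℝ → ℝ} (hη : ContDiff ℝ 1 η)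
    (a b : ℝ) :
    ∫ t in a..b, deriv η t • F t = η b • F b - η a • F a - ∫ t in a..b, η t • deriv F t := by
  have hη' : Continuous (deriv η) := hη.continuous_deriv le_rfl
  have hi1 : IntervalIntegrable (fun t => deriv η t • F t) volume a b :=
    (hη'.smul hF.continuous).intervalIntegrable a b
  have hi2 : IntervalIntegrable (fun t => η t • deriv F t) volume a b :=
    (intervalIntegrable_deriv hF a b).continuousOn_smul hη.continuous.continuousOn
  refine ext_inner_left ℝ fun e => ?_
  have hηac : AbsolutelyContinuousOnInterval η a b :=
    hη.contDiffOn.absolutelyContinuousOnInterval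
  have h1 := (absolutelyContinuousOnInterval_inner hF e a b).integral_mul_deriv_eq_deriv_mul hηac
  have h2 := (innerSL ℝ e).intervalIntegral_comp_comm hi1
  have h3 := (innerSL ℝ e).intervalIntegral_comp_comm hi2
  simp only [innerSL_apply_apply, inner_smul_right] at h2 h3
  rw [inner_sub_right, inner_sub_right, inner_smul_right, inner_smul_right, ← h2, ← h3]
  simp only [mul_comm (deriv η _)]
  rw [h1, mul_comm (η b), mul_comm (η a)]
  congr 1
  refine intervalIntegral.integral_congr_ae ?_
  filter_upwards [ae_deriv_inner_eq hF e] with t ht _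
  rw [ht, mul_comm]

/-- The length of a Lipschitz curve is at most the integral of its speed. -/
theorem eVariationOn_le_lintegral_deriv (hF : LipschitzWith K F) (a b : ℝ) :
    eVariationOn F (Icc a b) ≤ ∫⁻ t in Ioc a b, ‖deriv F t‖ₑ := by
  rcases lt_or_ge b a with hab | hab
  · rw [Icc_eq_empty hab.not_ge, eVariationOn.subsingleton F subsingleton_empty]
    exact zero_le
  have hi : ∀ x y, IntervalIntegrable (fun t => ‖deriv F t‖) volume x y := fun x y =>
    (intervalIntegrable_deriv hF x y).norm
  set V : ℝ → ℝ := fun x => ∫ t in a..x, ‖deriv F t‖ with hV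
  have hsub : ∀ x y, V y - V x = ∫ t in x..y, ‖deriv F t‖ := fun x y =>
    intervalIntegral.integral_interval_sub_left (hi a y) (hi a x)
  have hmono : Monotone V := fun x y hxy => by
    rw [← sub_nonneg, hsub]
    exact intervalIntegral.integral_nonneg hxy fun t _ => norm_nonneg _
  have hdist : ∀ x y, edist (F x) (F y) ≤ edist (V x) (V y) := by
    have key : ∀ x y, x ≤ y → dist (F x) (F y) ≤ dist (V x) (V y) := fun x y hxy => by
      rw [dist_comm, dist_eq_norm, dist_comm, Real.dist_eq, hsub,
        ← integral_deriv_eq_sub_of_lipschitzWith hF x y]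
      exact (intervalIntegral.norm_integral_le_integral_norm hxy).trans (le_abs_self _)
    intro x y
    rw [edist_dist, edist_dist]
    refine ENNReal.ofReal_le_ofReal ?_
    rcases le_total x y with h | h
    · exact key x y h
    · rw [dist_comm, dist_comm (V x)]; exact key y x h
  calc eVariationOn F (Icc a b) ≤ eVariationOn V (Icc a b) :=
        iSup_mono fun u => Finset.sum_le_sum fun i _ => hdist _ _
    _ ≤ ENNReal.ofReal (V b - V a) := by
        have := (hmono.monotoneOn (Icc a b)).eVariationOn_eq (left_mem_Icc.2 hab)
          (right_mem_Icc.2 hab)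
        rw [inter_self] at this
        exact this.le
    _ = ∫⁻ t in Ioc a b, ‖deriv F t‖ₑ := by
        rw [hsub, intervalIntegral.integral_of_le hab,
          ofReal_integral_norm_eq_lintegral_enorm (intervalIntegrable_deriv hF a b).1]

end Line

/-! ### Curves parametrized by arc length -/

section Curve

variable {ℓ : ℝ} [hℓ : Fact (0 < ℓ)] {E : Type*} [NormedAddCommGroup E]
  {f : AddCircle ℓ → E}

theorem IsArcLengthClosedCurve.eVariationOn_uIcc (hf : IsArcLengthClosedCurve f) (a b : ℝ) :
    eVariationOn (lift f) (uIcc a b) = ENNReal.ofReal |b - a| := by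
  have h := hf.unitSpeed (mem_univ (min a b)) (mem_univ (max a b))
  rw [univ_inter, NNReal.coe_one, one_mul, max_sub_min_eq_abs] at h
  exact h

theorem IsArcLengthClosedCurve.lipschitzWith_lift (hf : IsArcLengthClosedCurve f) :
    LipschitzWith 1 (lift f) := by
  intro a b
  have h := eVariationOn.edist_le (lift f) (left_mem_uIcc (a := a) (b := b)) right_mem_uIcc
  rw [hf.eVariationOn_uIcc] at h
  rw [ENNReal.coe_one, one_mul, edist_dist a, dist_comm, Real.dist_eq]
  exact h

theorem IsArcLengthClosedCurve.intrinsicDist_eq (hf : IsArcLengthClosedCurve f)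
    (x y : AddCircle ℓ) : intrinsicDist f x y = ENNReal.ofReal ‖y - x‖ := by
  simp only [intrinsicDist, hf.eVariationOn_uIcc]
  refine le_antisymm ?_ (le_iInf fun a => le_iInf fun b => le_iInf fun ha => le_iInf fun hb => ?_)
  · obtain ⟨a, rfl⟩ := QuotientAddGroup.mk_surjective x
    obtain ⟨h, hh, hyx⟩ : ∃ h ∈ Ioc (-(ℓ / 2)) (-(ℓ / 2) + ℓ),
        (h : AddCircle ℓ) = y - (a : AddCircle ℓ) := by
      have := AddCircle.coe_image_Ioc_eq ℓ (-(ℓ / 2))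
      have h2 : y - (a : AddCircle ℓ) ∈ (univ : Set (AddCircle ℓ)) := mem_univ _
      rw [← this] at h2
      exact h2
    have hh' : h ∈ Ioc (-(ℓ / 2)) (ℓ / 2) := by
      convert hh using 2
      ring
    refine iInf_le_of_le a (iInf_le_of_le (a + h) (iInf_le_of_le rfl (iInf_le_of_le ?_ ?_)))
    · rw [AddCircle.coe_add, hyx]; abel
    · rw [add_sub_cancel_left]
      refine ENNReal.ofReal_le_ofReal ?_
      rw [← norm_coe_of_mem_Ioc hh', hyx]
  · subst ha hb
    refine ENNReal.ofReal_le_ofReal ?_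
    rw [← AddCircle.coe_sub, AddCircle.norm_eq]
    have := round_le ((b - a) / ℓ) 0
    have hpos := hℓ.out
    have e1 : b - a - round (ℓ⁻¹ * (b - a)) * ℓ
        = ℓ * ((b - a) / ℓ - round ((b - a) / ℓ)) := by
      rw [inv_mul_eq_div]; field_simp
    have e2 : b - a = ℓ * ((b - a) / ℓ) := by field_simp
    rw [e1, e2, mul_div_cancel_left₀ _ hpos.ne', abs_mul, abs_mul]
    exact mul_le_mul_of_nonneg_left (by simpa using this) (abs_nonneg _)

theorem IsArcLengthClosedCurve.norm_sub_le (hf : IsArcLengthClosedCurve f) (s : AddCircle ℓ)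
    (h : ℝ) : ‖f (s + (h : ℝ)) - f s‖ ≤ |h| := by
  obtain ⟨t, rfl⟩ := QuotientAddGroup.mk_surjective s
  have := hf.lipschitzWith_lift.dist_le_mul (t + h) t
  simpa [lift, dist_eq_norm] using this

theorem IsArcLengthClosedCurve.norm_sub_pos (hf : IsArcLengthClosedCurve f) (s : AddCircle ℓ)
    {h : ℝ} (hh : h ∈ Ioc (-(ℓ / 2)) (ℓ / 2)) (h0 : h ≠ 0) : 0 < ‖f (s + (h : ℝ)) - f s‖ := by
  rw [norm_pos_iff, sub_ne_zero]
  intro heq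
  have h1 : (h : AddCircle ℓ) = 0 := by simpa using hf.injective heq
  have h2 := norm_coe_of_mem_Ioc hh
  rw [h1, norm_zero] at h2
  exact h0 (abs_eq_zero.1 h2.symm)

/-- The energy in terms of a base point `s` and an increment `h`. -/
theorem IsArcLengthClosedCurve.energy_eq (hf : IsArcLengthClosedCurve f) (Φ : ℝ → ℝ) (p : ℝ) :
    energy Φ p f = ∫⁻ s : AddCircle ℓ, ∫⁻ h in Ioc (-(ℓ / 2)) (ℓ / 2),
      ((ENNReal.ofReal (Φ ‖f (s + (h : ℝ)) - f s‖))⁻¹ - (ENNReal.ofReal (Φ |h|))⁻¹) ^ p := by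
  refine lintegral_congr fun s => ?_
  rw [lintegral_eq_lintegral_add_coe _ s]
  refine setLIntegral_congr_fun measurableSet_Ioc fun h hh => ?_
  rw [hf.intrinsicDist_eq, add_sub_cancel_left, ENNReal.toReal_ofReal (norm_nonneg _),
    norm_coe_of_mem_Ioc hh]

variable [NormedSpace ℝ E]

omit hℓ in
theorem deriv_lift_eq_of_coe_eq (f : AddCircle ℓ → E) {a b : ℝ}
    (h : (a : AddCircle ℓ) = (b : AddCircle ℓ)) : deriv (lift f) a = deriv (lift f) b := by
  have h1 : lift f = fun t => lift f (t + (b - a)) := by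
    ext t
    simp [lift, h]
  conv_lhs => rw [h1]
  rw [deriv_comp_add_const, add_sub_cancel]

/-- The classical derivative of a closed curve, as a map on the circle; it is `0` where the
lift is not differentiable. -/
def velocity (f : AddCircle ℓ → E) (x : AddCircle ℓ) : E :=
  deriv (lift f) (AddCircle.measurableEquivIoc ℓ 0 x : Ioc 0 (0 + ℓ))

theorem velocity_coe (f : AddCircle ℓ → E) (t : ℝ) :
    velocity f (t : AddCircle ℓ) = deriv (lift f) t :=
  deriv_lift_eq_of_coe_eq f ((AddCircle.measurableEquivIoc ℓ 0).symm_apply_apply (t : AddCircle ℓ))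

theorem norm_velocity_le (hf : IsArcLengthClosedCurve f) (x : AddCircle ℓ) :
    ‖velocity f x‖ ≤ 1 := by
  exact_mod_cast norm_deriv_le_of_lipschitz hf.lipschitzWith_lift

variable [MeasurableSpace E] [BorelSpace E]

theorem measurable_velocity [CompleteSpace E] (f : AddCircle ℓ → E) : Measurable (velocity f) :=
  (measurable_deriv _).comp
    (measurable_subtype_coe.comp (AddCircle.measurableEquivIoc ℓ 0).measurable)

end Curve

section CurveInner

variable {ℓ : ℝ} [hℓ : Fact (0 < ℓ)] {E : Type*} [NormedAddCommGroup E] [InnerProductSpace ℝ E]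
  [FiniteDimensional ℝ E] {f : AddCircle ℓ → E}

/-- The speed is at most `1` and its integral is at least the total length `ℓ`. -/
theorem ae_norm_velocity_eq_one (hf : IsArcLengthClosedCurve f) :
    ∀ᵐ x, ‖velocity f x‖ = 1 := by
  have hle : ∀ x, ‖velocity f x‖ₑ ≤ 1 := fun x => by
    rw [← ofReal_norm, ENNReal.ofReal_le_one]
    exact norm_velocity_le hf x
  have hvar : ∫⁻ _ : AddCircle ℓ, 1 ≤ ∫⁻ x : AddCircle ℓ, ‖velocity f x‖ₑ := by
    have h1 := eVariationOn_le_lintegral_deriv hf.lipschitzWith_lift 0 ℓ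
    have h2 := hf.eVariationOn_uIcc 0 ℓ
    rw [uIcc_of_le hℓ.out.le, sub_zero, abs_of_pos hℓ.out] at h2
    rw [lintegral_one, AddCircle.measure_univ, ← AddCircle.lintegral_preimage ℓ 0, zero_add, ← h2]
    simpa only [velocity_coe] using h1
  have h := ae_eq_of_ae_le_of_lintegral_le (Eventually.of_forall hle)
    (((lintegral_mono hle).trans_lt (by simp)).ne) aemeasurable_const hvar
  filter_upwards [h] with x hx
  rw [← toReal_enorm, hx, ENNReal.toReal_one]

variable [MeasurableSpace E] [BorelSpace E]

theorem isWeakDeriv_velocity (hf : IsArcLengthClosedCurve f) : IsWeakDeriv f (velocity f) := by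
  obtain ⟨K, hK⟩ := hf.lipschitz
  have hfc : Continuous f := hK.continuous
  refine ⟨hfc.integrable_of_hasCompactSupport (HasCompactSupport.of_compactSpace f), ?_, ?_⟩
  · refine Integrable.of_bound (C := 1) (measurable_velocity f).aestronglyMeasurable ?_
    exact Eventually.of_forall (norm_velocity_le hf)
  · intro η hη hper
    have h1 := integral_deriv_smul_eq_sub hf.lipschitzWith_lift
      (hη.of_le (by exact_mod_cast le_top)) 0 ℓ
    have h2 : η ℓ = η 0 := by simpa using hper 0
    have h3 : lift f ℓ = lift f 0 := by simp only [lift, AddCircle.coe_period, AddCircle.coe_zero]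
    rw [h1, h2, h3, sub_self, zero_sub]
    simp only [lift, velocity_coe]

end CurveInner

/-! ### Uniqueness of the weak derivative -/

section Weak

variable {ℓ : ℝ} [hℓ : Fact (0 < ℓ)]

/-- The periodic extension of a test function supported in `(0, ℓ)` is smooth. -/
theorem contDiff_comp_toIcoMod {η : ℝ → ℝ} {n : WithTop ℕ∞} (hη : ContDiff ℝ n η)
    (hsupp : ∀ x, x ∉ Ioo 0 ℓ → η x = 0) :
    ContDiff ℝ n fun t => η (toIcoMod hℓ.out 0 t) := by
  rw [contDiff_iff_contDiffAt]
  intro t₀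
  set m := toIcoDiv hℓ.out 0 t₀ with hm
  have hpos := hℓ.out
  have ht₀ : t₀ - m * ℓ ∈ Ico 0 ℓ := by
    have := toIcoMod_mem_Ico hℓ.out 0 t₀
    rw [toIcoMod, zsmul_eq_mul, zero_add] at this
    exact this
  -- Near `t₀` at most two translates of `η` are nonzero.
  have hev : (fun t => η (toIcoMod hℓ.out 0 t)) =ᶠ[𝓝 t₀]
      fun t => η (t - m * ℓ) + η (t - m * ℓ + ℓ) := by
    have hU : Ioo (m * ℓ - ℓ) (m * ℓ + ℓ) ∈ 𝓝 t₀ :=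
      Ioo_mem_nhds (by linarith [ht₀.1]) (by linarith [ht₀.2])
    filter_upwards [hU] with t ht
    rcases le_or_gt 0 (t - m * ℓ) with h | h
    · have e : toIcoMod hℓ.out 0 t = t - m * ℓ := by
        rw [toIcoMod_eq_iff]
        refine ⟨⟨h, by linarith [ht.2]⟩, m, ?_⟩
        rw [zsmul_eq_mul]; ring
      rw [e, hsupp (t - m * ℓ + ℓ) fun h' => by linarith [h'.2], add_zero]
    · have e : toIcoMod hℓ.out 0 t = t - m * ℓ + ℓ := by
        rw [toIcoMod_eq_iff]
        refine ⟨⟨by linarith [ht.1], by linarith⟩, m - 1, ?_⟩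
        rw [zsmul_eq_mul]; push_cast; ring
      rw [e, hsupp (t - m * ℓ) fun h' => by linarith [h'.1], zero_add]
  refine ContDiffAt.congr_of_eventuallyEq (ContDiff.contDiffAt ?_) hev
  exact (hη.comp (contDiff_id.sub contDiff_const)).add
    (hη.comp ((contDiff_id.sub contDiff_const).add contDiff_const))

/-- Weak derivatives on the circle are unique: test functions supported in `(0, ℓ)` suffice. -/
theorem IsWeakDeriv.ae_eq {E : Type*} [NormedAddCommGroup E] [NormedSpace ℝ E] [CompleteSpace E]
    {f g₁ g₂ : AddCircle ℓ → E} (h₁ : IsWeakDeriv f g₁) (h₂ : IsWeakDeriv f g₂) :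
    g₁ =ᵐ[volume] g₂ := by
  have hint : ∀ {g : AddCircle ℓ → E}, Integrable g volume →
      IntegrableOn (lift g) (Ioc 0 ℓ) := fun {g} hg => by
    have := (AddCircle.measurePreserving_mk ℓ 0).integrable_comp_of_integrable hg
    rwa [zero_add] at this
  have hD : IntegrableOn (fun t => lift g₁ t - lift g₂ t) (Ioc 0 ℓ) :=
    (hint h₁.2.1).sub (hint h₂.2.1)
  have hae : ∀ᵐ t : ℝ, t ∈ Ioo 0 ℓ → lift g₁ t - lift g₂ t = 0 := by
    refine isOpen_Ioo.ae_eq_zero_of_integral_contDiff_smul_eq_zero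
      (hD.mono_set Ioo_subset_Ioc_self).locallyIntegrableOn fun η hη _ hsupp => ?_
    have hη0 : ∀ x, x ∉ Ioo 0 ℓ → η x = 0 := fun x hx =>
      image_eq_zero_of_notMem_tsupport fun h => hx (hsupp h)
    have hper : Function.Periodic (fun t => η (toIcoMod hℓ.out 0 t)) ℓ := fun t => by
      simp only [toIcoMod_add_right]
    have hsm := contDiff_comp_toIcoMod hη hη0
    have hcongr : ∀ g : AddCircle ℓ → E,
        ∫ t in (0 : ℝ)..ℓ, η (toIcoMod hℓ.out 0 t) • lift g t =
          ∫ t in (0 : ℝ)..ℓ, η t • lift g t := by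
      intro g
      refine intervalIntegral.integral_congr fun t ht => ?_
      rw [uIcc_of_le hℓ.out.le] at ht
      rcases eq_or_lt_of_le ht.2 with rfl | h
      · have h0 : toIcoMod hℓ.out 0 t = 0 := by simpa using toIcoMod_apply_right hℓ.out 0
        rw [h0, hη0 0 (by simp), hη0 t (by simp)]
      · rw [(toIcoMod_eq_self hℓ.out).2 ⟨ht.1, by simpa using h⟩]
    have e₁ := h₁.2.2 _ hsm hper
    have e₂ := h₂.2.2 _ hsm hper
    rw [e₁, neg_inj, hcongr, hcongr] at e₂
    have hsmul : ∀ {g : AddCircle ℓ → E}, Integrable g volume →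
        IntervalIntegrable (fun t => η t • lift g t) volume 0 ℓ := fun hg =>
      ((intervalIntegrable_iff_integrableOn_Ioc_of_le hℓ.out.le).2 (hint hg)).continuousOn_smul
        hη.continuous.continuousOn
    calc ∫ t, η t • (lift g₁ t - lift g₂ t) = ∫ t in Ioc 0 ℓ, η t • (lift g₁ t - lift g₂ t) := by
          refine (setIntegral_eq_integral_of_forall_compl_eq_zero fun t ht => ?_).symm
          rw [hη0 t fun h => ht (Ioo_subset_Ioc_self h), zero_smul]
      _ = ∫ t in (0 : ℝ)..ℓ, (η t • lift g₁ t - η t • lift g₂ t) := by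
          rw [intervalIntegral.integral_of_le hℓ.out.le]
          simp only [smul_sub]
      _ = 0 := by
          rw [intervalIntegral.integral_sub (hsmul h₁.2.1) (hsmul h₂.2.1), e₂, sub_self]
  have hzero : ∫⁻ x : AddCircle ℓ, ‖g₁ x - g₂ x‖ₑ = 0 := by
    rw [← AddCircle.lintegral_preimage ℓ 0, zero_add, ← setLIntegral_congr Ioo_ae_eq_Ioc,
      setLIntegral_eq_zero_iff' measurableSet_Ioo]
    · filter_upwards [hae] with t ht hmem
      simpa [lift] using ht hmem
    · exact ((hD.mono_set Ioo_subset_Ioc_self).aestronglyMeasurable.enorm)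
  have hzero := (lintegral_eq_zero_iff' (h₁.2.1.sub h₂.2.1).aestronglyMeasurable.enorm).1 hzero
  filter_upwards [hzero] with x hx
  simpa [sub_eq_zero] using hx

end Weak


/-! ### The energy and the defect `1 - ‖f(s + h) - f(s)‖ / |h|` -/

section Defect

variable {ℓ : ℝ} [hℓ : Fact (0 < ℓ)] {E : Type*} [NormedAddCommGroup E]

/-- The defect `1 - ‖f(s + h) - f(s)‖ / |h|` of the chord of increment `h` at `s`. -/
def defect (f : AddCircle ℓ → E) (s : AddCircle ℓ) (h : ℝ) : ℝ :=
  1 - ‖f (s + (h : ℝ)) - f s‖ / |h|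

/-- The model energy: the energy with the integrand replaced by `(defect / Φ(|h|))^p`, to which it
is comparable. -/
def defectEnergy (Φ : ℝ → ℝ) (p : ℝ) (f : AddCircle ℓ → E) : ℝ≥0∞ :=
  ∫⁻ s : AddCircle ℓ, ∫⁻ h, ENNReal.ofReal (defect f s h) ^ p * kernel Φ p (ℓ / 2) h

theorem inv_ofReal_sub_inv_ofReal {a b : ℝ} (ha : 0 < a) (hb : 0 < b) :
    (ENNReal.ofReal a)⁻¹ - (ENNReal.ofReal b)⁻¹ = ENNReal.ofReal (a⁻¹ - b⁻¹) := by
  rw [← ENNReal.ofReal_inv_of_pos ha, ← ENNReal.ofReal_inv_of_pos hb,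
    ENNReal.ofReal_sub _ (inv_pos.2 hb).le]

variable {Φ : ℝ → ℝ} {p : ℝ} {f : AddCircle ℓ → E}

/-- The model energy is at most a multiple of the energy; the constant does not depend on the
curve. -/
theorem exists_defectEnergy_le_energy (hΦ : IsAdmissible Φ p) (hp : 0 ≤ p) (ℓ : ℝ)
    [Fact (0 < ℓ)] :
    ∃ κ : ℝ, 0 < κ ∧ ∀ {E : Type} [NormedAddCommGroup E] {f : AddCircle ℓ → E},
      IsArcLengthClosedCurve f →
      ENNReal.ofReal κ ^ p * defectEnergy Φ p f ≤ energy Φ p f := by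
  obtain ⟨κ, hκ, hb⟩ := hΦ.exists_le_inv_sub_inv (ℓ / 2)
  refine ⟨κ, hκ, fun {E} _ f hf => ?_⟩
  have htop : ENNReal.ofReal κ ^ p ≠ ⊤ := ENNReal.rpow_ne_top_of_nonneg hp ENNReal.ofReal_ne_top
  rw [hf.energy_eq, defectEnergy, ← lintegral_const_mul' _ _ htop]
  refine lintegral_mono fun s => ?_
  rw [lintegral_mul_kernel, ← lintegral_const_mul' _ _ htop]
  -- The single point `h = 0`, where the kernel is infinite, is discarded.
  refine setLIntegral_mono_ae' measurableSet_Ioc ?_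
  filter_upwards [Measure.ae_ne volume (0 : ℝ)] with h h0 hh
  have hpos := hf.norm_sub_pos s hh h0
  have hle := hf.norm_sub_le s h
  have habs : |h| ≤ ℓ / 2 := abs_le.2 ⟨hh.1.le, hh.2⟩
  have hh0 : 0 < |h| := abs_pos.2 h0
  rw [inv_ofReal_sub_inv_ofReal (hΦ.pos hpos) (hΦ.pos hh0), ← ENNReal.mul_rpow_of_nonneg _ _ hp,
    ← ENNReal.mul_rpow_of_nonneg _ _ hp, ← ENNReal.ofReal_inv_of_pos (hΦ.pos hh0), ← mul_assoc,
    ← ENNReal.ofReal_mul hκ.le, ← ENNReal.ofReal_mul']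
  · exact ENNReal.rpow_le_rpow (ENNReal.ofReal_le_ofReal (hb _ _ hpos hle habs)) hp
  · exact (inv_pos.2 (hΦ.pos hh0)).le

/-- The energy of a bi-Lipschitz curve is at most a multiple of the model energy. -/
theorem exists_energy_le_defectEnergy (hΦ : IsAdmissible Φ p) (hp : 0 < p)
    (hf : IsArcLengthClosedCurve f) (hbi : IsBiLipschitz f) :
    ∃ A : ℝ, energy Φ p f ≤ ENNReal.ofReal A ^ p * defectEnergy Φ p f := by
  obtain ⟨-, K, hK⟩ := hbi
  obtain ⟨A, hA, hb⟩ := hΦ.exists_inv_sub_inv_le (ℓ / 2) (K + 1) (by positivity)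
  refine ⟨A, ?_⟩
  have htop : ENNReal.ofReal A ^ p ≠ ⊤ :=
    ENNReal.rpow_ne_top_of_nonneg hp.le ENNReal.ofReal_ne_top
  rw [hf.energy_eq, defectEnergy, ← lintegral_const_mul' _ _ htop]
  refine lintegral_mono fun s => ?_
  rw [lintegral_mul_kernel, ← lintegral_const_mul' _ _ htop]
  refine setLIntegral_mono_ae' measurableSet_Ioc ?_
  filter_upwards [Measure.ae_ne volume (0 : ℝ)] with h h0 hh
  have hpos := hf.norm_sub_pos s hh h0
  have hle := hf.norm_sub_le s h
  have habs : |h| ≤ ℓ / 2 := abs_le.2 ⟨hh.1.le, hh.2⟩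
  have hh0 : 0 < |h| := abs_pos.2 h0
  have hlow : |h| ≤ (K + 1) * ‖f (s + (h : ℝ)) - f s‖ := by
    have h1 := hK.le_mul_dist (s + (h : ℝ)) s
    rw [dist_eq_norm, dist_eq_norm, add_sub_cancel_left, norm_coe_of_mem_Ioc hh] at h1
    linarith
  rw [inv_ofReal_sub_inv_ofReal (hΦ.pos hpos) (hΦ.pos hh0), ← ENNReal.mul_rpow_of_nonneg _ _ hp.le,
    ← ENNReal.mul_rpow_of_nonneg _ _ hp.le, ← ENNReal.ofReal_inv_of_pos (hΦ.pos hh0), ← mul_assoc,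
    ← ENNReal.ofReal_mul hA, ← ENNReal.ofReal_mul']
  · exact ENNReal.rpow_le_rpow (ENNReal.ofReal_le_ofReal (hb _ _ hpos hle habs hlow)) hp.le
  · exact (inv_pos.2 (hΦ.pos hh0)).le

end Defect

/-! ### Sobolev regularity bounds the energy -/

section Upper

instance isProbabilityMeasure_restrict_Ioc_zero_one :
    IsProbabilityMeasure (volume.restrict (Ioc (0 : ℝ) 1)) :=
  ⟨by simp⟩

variable {ℓ : ℝ} [hℓ : Fact (0 < ℓ)]

/-- A property that holds almost everywhere on the circle holds almost everywhere on the line. -/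
theorem ae_coe_of_ae {P : AddCircle ℓ → Prop} (h : ∀ᵐ x, P x) : ∀ᵐ t : ℝ, P (t : AddCircle ℓ) := by
  have h1 : ∀ᵐ t : ℝ ∂(volume.restrict (⋃ n : ℤ, Ioc (0 + n • ℓ) (0 + (n + 1) • ℓ))),
      P (t : AddCircle ℓ) := by
    rw [ae_restrict_iUnion_iff]
    intro n
    have h2 := (AddCircle.measurePreserving_mk ℓ (0 + n • ℓ)).quasiMeasurePreserving.ae h
    rwa [add_assoc, ← add_one_zsmul] at h2
  rwa [iUnion_Ioc_add_zsmul hℓ.out, Measure.restrict_univ] at h1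

omit hℓ in
theorem measurable_increment_mul {E : Type*} [NormedAddCommGroup E]
    [MeasurableSpace E] [BorelSpace E] [SecondCountableTopology E] {q : ℝ}
    {g : AddCircle ℓ → E} (hg : Measurable g) :
    Measurable fun z : (AddCircle ℓ × ℝ) × ℝ =>
      ‖g (z.1.1 + ((z.2 * z.1.2 : ℝ))) - g z.1.1‖ₑ ^ q :=
  (measurable_increment_integrand hg).comp
    ((measurable_fst.comp measurable_fst).prodMk
      (measurable_snd.mul (measurable_snd.comp measurable_fst)))

/-- Averages over rescaled increments are controlled by the Gagliardo functional. -/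
theorem lintegral_increment_mul_kernel_le {E : Type*} [NormedAddCommGroup E] [MeasurableSpace E]
    [BorelSpace E] [SecondCountableTopology E] {Φ : ℝ → ℝ} {p : ℝ} (hΦ : IsAdmissible Φ p)
    (hp : 0 ≤ p) {φ : ℝ → ℝ} (hφm : Measurable φ) (hφ : ∀ k, 0 ≤ k → 0 ≤ φ k)
    (hscale : ∀ k x, 0 ≤ k → 0 ≤ x → Φ (k * x) ≤ φ k * Φ x) {ε : ℝ} (hε : 0 < ε) (hε1 : ε ≤ 1)
    {g : AddCircle ℓ → E} (hg : Measurable g) :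
    ∫⁻ h, (∫⁻ u in Ioc (0 : ℝ) 1, increment (2 * p) g (u * (ε * h))) * kernel Φ p (ℓ / 2) h ≤
      scalingIntegral φ p ε / ENNReal.ofReal ε * gagliardo Φ p g := by
  have hinc := measurable_increment (q := 2 * p) hg
  have hK := measurable_kernel (L := ℓ / 2) hΦ
  have hm : Measurable fun z : ℝ × ℝ => increment (2 * p) g (z.2 * (ε * z.1)) :=
    hinc.comp (measurable_snd.mul (measurable_fst.const_mul ε))
  have hm' : ∀ h : ℝ, Measurable fun u : ℝ => increment (2 * p) g (u * (ε * h)) := fun h =>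
    hinc.comp (measurable_id.mul_const (ε * h))
  have hmK : Measurable (Function.uncurry fun h u : ℝ =>
      increment (2 * p) g (u * (ε * h)) * kernel Φ p (ℓ / 2) h) :=
    hm.mul (hK.comp measurable_fst)
  have hψ : Measurable fun t : ℝ => ENNReal.ofReal (φ t ^ p / t) :=
    ((hφm.pow_const p).div measurable_id).ennreal_ofReal
  have hψ' : Measurable fun u : ℝ => ENNReal.ofReal (φ (ε * u) ^ p / (ε * u)) :=
    hψ.comp (measurable_id.const_mul ε)
  have hsc : ∫⁻ u in Ioc (0 : ℝ) 1, ENNReal.ofReal (φ (ε * u) ^ p / (ε * u)) =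
      scalingIntegral φ p ε / ENNReal.ofReal ε := by
    have h1 : ∀ u, (Ioc (0 : ℝ) 1).indicator
        (fun u => ENNReal.ofReal (φ (ε * u) ^ p / (ε * u))) u =
        (Ioc 0 ε).indicator (fun t => ENNReal.ofReal (φ t ^ p / t)) (ε * u) := fun u => by
      have : u ∈ Ioc (0 : ℝ) 1 ↔ ε * u ∈ Ioc 0 ε := by
        simp only [mem_Ioc]
        exact and_congr (by simp [hε]) (by
          rw [mul_le_iff_le_one_right hε])
      by_cases hu : u ∈ Ioc (0 : ℝ) 1
      · rw [indicator_of_mem hu, indicator_of_mem (this.1 hu)]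
      · rw [indicator_of_notMem hu, indicator_of_notMem (fun h => hu (this.2 h))]
    rw [← lintegral_indicator measurableSet_Ioc, lintegral_congr h1,
      lintegral_comp_mul_left_of_pos (hψ.indicator measurableSet_Ioc) hε,
      lintegral_indicator measurableSet_Ioc, ENNReal.ofReal_inv_of_pos hε, mul_comm,
      ← div_eq_mul_inv]
    rfl
  calc _ = ∫⁻ h, ∫⁻ u in Ioc (0 : ℝ) 1,
        increment (2 * p) g (u * (ε * h)) * kernel Φ p (ℓ / 2) h := by
        refine lintegral_congr fun h => ?_
        rw [lintegral_mul_const _ (hm' h)]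
    _ = ∫⁻ u in Ioc (0 : ℝ) 1, ∫⁻ h,
        increment (2 * p) g ((ε * u) * h) * kernel Φ p (ℓ / 2) h := by
        rw [lintegral_lintegral_swap hmK.aemeasurable]
        refine lintegral_congr fun u => lintegral_congr fun h => ?_
        rw [← mul_assoc, mul_comm u ε]
    _ ≤ ∫⁻ u in Ioc (0 : ℝ) 1, ENNReal.ofReal (φ (ε * u) ^ p / (ε * u)) * gagliardo Φ p g := by
        refine setLIntegral_mono' measurableSet_Ioc fun u hu => ?_
        exact lintegral_comp_mul_kernel_le hΦ hp hφ hscale (mul_pos hε hu.1)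
          (mul_le_one₀ hε1 hu.1.le hu.2) hinc
    _ = _ := by
        rw [lintegral_mul_const _ hψ', hsc]

variable {E : Type*} [NormedAddCommGroup E] [InnerProductSpace ℝ E] [FiniteDimensional ℝ E]
  {f : AddCircle ℓ → E}

/-- The chord is the mean of the unit tangents along the arc, so testing it against the unit
tangent `e` at `s` bounds the defect by the mean of `1 - ⟪f', e⟫ = ‖f' - e‖² / 2`. -/
theorem defect_le_lintegral (hf : IsArcLengthClosedCurve f) {s : AddCircle ℓ}
    (hs : ‖velocity f s‖ = 1) {h : ℝ} (h0 : h ≠ 0) :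
    ENNReal.ofReal (defect f s h) ≤
      ∫⁻ u in Ioc (0 : ℝ) 1, ‖velocity f (s + ((u * h : ℝ))) - velocity f s‖ₑ ^ (2 : ℝ) := by
  obtain ⟨t, rfl⟩ := QuotientAddGroup.mk_surjective s
  have hcoe : (QuotientAddGroup.mk t : AddCircle ℓ) = (t : AddCircle ℓ) := rfl
  set e := velocity f (QuotientAddGroup.mk t : AddCircle ℓ) with he
  have hL := hf.lipschitzWith_lift
  set F := lift f with hF
  have hi := intervalIntegrable_deriv hL t (t + h)
  have hunit : ∀ᵐ x : ℝ, ‖deriv F x‖ = 1 := by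
    filter_upwards [ae_coe_of_ae (ae_norm_velocity_eq_one hf)] with x hx
    rwa [velocity_coe] at hx
  have hb : ∀ x, ‖deriv F x - e‖ ^ 2 ≤ 4 := fun x => by
    have h1 : ‖deriv F x‖ ≤ 1 := by exact_mod_cast norm_deriv_le_of_lipschitz hL
    have h2 := _root_.norm_sub_le (deriv F x) e
    have h3 : ‖deriv F x - e‖ ≤ 2 := by linarith
    nlinarith [norm_nonneg (deriv F x - e)]
  have hmeas : ∀ c d : ℝ, AEStronglyMeasurable (fun u => ‖deriv F (c + d * u) - e‖ ^ 2)
      (volume.restrict (Ioc (0 : ℝ) 1)) := fun c d =>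
    (((stronglyMeasurable_deriv F).comp_measurable
      ((measurable_id.const_mul d).const_add c)).sub stronglyMeasurable_const).norm.pow 2
      |>.aestronglyMeasurable
  have hint : IntervalIntegrable (fun x => ‖deriv F x - e‖ ^ 2) volume t (t + h) := by
    refine (intervalIntegrable_const (c := (4 : ℝ))).mono_fun
      (((stronglyMeasurable_deriv F).sub stronglyMeasurable_const).norm.pow 2).aestronglyMeasurable
      (Eventually.of_forall fun x => ?_)
    have := hb x
    simpa using this
  have hinner : inner ℝ e (F (t + h) - F t) =
      h - (∫ x in t..t + h, ‖deriv F x - e‖ ^ 2) / 2 := by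
    have h1 := (innerSL ℝ e).intervalIntegral_comp_comm hi
    simp only [innerSL_apply_apply] at h1
    rw [← integral_deriv_eq_sub_of_lipschitzWith hL, ← h1]
    have h2 : ∫ x in t..t + h, inner ℝ e (deriv F x) =
        ∫ x in t..t + h, (1 - ‖deriv F x - e‖ ^ 2 / 2) := by
      refine intervalIntegral.integral_congr_ae ?_
      filter_upwards [hunit] with x hx _
      rw [norm_sub_sq_real, hx, hs, real_inner_comm]
      ring
    rw [h2, intervalIntegral.integral_sub intervalIntegrable_const (hint.div_const 2),
      intervalIntegral.integral_div]
    simp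
  have hsubst : ∫ u in (0 : ℝ)..1, ‖deriv F (t + h * u) - e‖ ^ 2 =
      h⁻¹ * ∫ x in t..t + h, ‖deriv F x - e‖ ^ 2 := by
    rw [intervalIntegral.integral_comp_add_mul (fun x => ‖deriv F x - e‖ ^ 2) h0]
    simp
  have hmain : defect f (QuotientAddGroup.mk t) h ≤
      ∫ u in (0 : ℝ)..1, ‖deriv F (t + h * u) - e‖ ^ 2 := by
    have hchord : f (QuotientAddGroup.mk t + (h : AddCircle ℓ)) - f (QuotientAddGroup.mk t) =
        F (t + h) - F t := by
      simp [hF, lift]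
    have hnn : 0 ≤ ∫ u in (0 : ℝ)..1, ‖deriv F (t + h * u) - e‖ ^ 2 :=
      intervalIntegral.integral_nonneg zero_le_one fun u _ => by positivity
    have hcs : h⁻¹ * inner ℝ e (F (t + h) - F t) ≤ ‖F (t + h) - F t‖ / |h| := by
      have h1 := abs_real_inner_le_norm e (F (t + h) - F t)
      rw [hs, one_mul] at h1
      calc _ ≤ |h⁻¹ * inner ℝ e (F (t + h) - F t)| := le_abs_self _
        _ = |h|⁻¹ * |inner ℝ e (F (t + h) - F t)| := by rw [abs_mul, abs_inv]
        _ ≤ |h|⁻¹ * ‖F (t + h) - F t‖ := by gcongr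
        _ = _ := inv_mul_eq_div _ _
    have hid : h⁻¹ * inner ℝ e (F (t + h) - F t) =
        1 - (∫ u in (0 : ℝ)..1, ‖deriv F (t + h * u) - e‖ ^ 2) / 2 := by
      rw [hinner, hsubst]
      field_simp
    rw [defect, hchord]
    linarith
  calc ENNReal.ofReal (defect f (QuotientAddGroup.mk t) h) ≤
        ENNReal.ofReal (∫ u in Ioc (0 : ℝ) 1, ‖deriv F (t + h * u) - e‖ ^ 2) := by
        rw [← intervalIntegral.integral_of_le zero_le_one]
        exact ENNReal.ofReal_le_ofReal hmain
    _ = ∫⁻ u in Ioc (0 : ℝ) 1, ENNReal.ofReal (‖deriv F (t + h * u) - e‖ ^ 2) := by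
        refine ofReal_integral_eq_lintegral_ofReal ?_ (Eventually.of_forall fun u => by positivity)
        refine Integrable.of_bound (C := 4) (hmeas t h) (Eventually.of_forall fun u => ?_)
        rw [Real.norm_of_nonneg (by positivity)]
        exact hb _
    _ = _ := by
        refine lintegral_congr fun u => ?_
        have : velocity f (QuotientAddGroup.mk t + ((u * h : ℝ) : AddCircle ℓ)) =
            deriv F (t + h * u) := by
          rw [hcoe, ← AddCircle.coe_add, velocity_coe, mul_comm u h]
        rw [this, ENNReal.ofReal_pow (norm_nonneg _), ofReal_norm, ENNReal.rpow_ofNat]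

variable [MeasurableSpace E] [BorelSpace E] [SecondCountableTopology E]

theorem defectEnergy_le_gagliardo {Φ : ℝ → ℝ} {p : ℝ} (hΦ : IsAdmissible Φ p) (hp : 1 ≤ p)
    {φ : ℝ → ℝ} (hφm : Measurable φ) (hφ : ∀ k, 0 ≤ k → 0 ≤ φ k)
    (hscale : ∀ k x, 0 ≤ k → 0 ≤ x → Φ (k * x) ≤ φ k * Φ x) (hf : IsArcLengthClosedCurve f) :
    defectEnergy Φ p f ≤ scalingIntegral φ p 1 * gagliardo Φ p (velocity f) := by
  have hv := measurable_velocity f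
  have hp0 : 0 ≤ p := by linarith
  have hK := measurable_kernel (L := ℓ / 2) hΦ
  have hm := measurable_increment_mul (q := 2 * p) hv
  have hm1 : Measurable fun z : AddCircle ℓ × ℝ => ∫⁻ u in Ioc (0 : ℝ) 1,
      ‖velocity f (z.1 + ((u * z.2 : ℝ))) - velocity f z.1‖ₑ ^ (2 * p) :=
    hm.lintegral_prod_right'
  have hm2 : Measurable (Function.uncurry fun (s : AddCircle ℓ) (h : ℝ) => (∫⁻ u in Ioc (0 : ℝ) 1,
      ‖velocity f (s + ((u * h : ℝ))) - velocity f s‖ₑ ^ (2 * p)) * kernel Φ p (ℓ / 2) h) :=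
    hm1.mul (hK.comp measurable_snd)
  have hm3 : ∀ h : ℝ, Measurable (Function.uncurry fun (s : AddCircle ℓ) (u : ℝ) =>
      ‖velocity f (s + ((u * h : ℝ))) - velocity f s‖ₑ ^ (2 * p)) := fun h =>
    hm.comp (f := fun z : AddCircle ℓ × ℝ => ((z.1, h), z.2))
      ((measurable_fst.prodMk measurable_const).prodMk measurable_snd)
  have hm4 : ∀ h : ℝ, Measurable fun s : AddCircle ℓ => ∫⁻ u in Ioc (0 : ℝ) 1,
      ‖velocity f (s + ((u * h : ℝ))) - velocity f s‖ₑ ^ (2 * p) := fun h =>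
    hm1.comp (f := fun s : AddCircle ℓ => (s, h)) (measurable_id.prodMk measurable_const)
  have hm5 : ∀ (s : AddCircle ℓ) (h : ℝ), Measurable fun u : ℝ =>
      ‖velocity f (s + ((u * h : ℝ))) - velocity f s‖ₑ ^ (2 : ℝ) := fun s h =>
    (measurable_increment_mul (q := 2) hv).comp (f := fun u : ℝ => ((s, h), u))
      (measurable_const.prodMk measurable_id)
  calc defectEnergy Φ p f ≤ ∫⁻ s : AddCircle ℓ, ∫⁻ h, (∫⁻ u in Ioc (0 : ℝ) 1,
        ‖velocity f (s + ((u * h : ℝ))) - velocity f s‖ₑ ^ (2 * p)) * kernel Φ p (ℓ / 2) h := by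
        refine lintegral_mono_ae ?_
        filter_upwards [ae_norm_velocity_eq_one hf] with s hs
        refine lintegral_mono_ae ?_
        filter_upwards [Measure.ae_ne volume (0 : ℝ)] with h h0
        gcongr
        refine (ENNReal.rpow_le_rpow (defect_le_lintegral hf hs h0) hp0).trans ?_
        refine (rpow_lintegral_le hp (hm5 s h).aemeasurable).trans_eq ?_
        exact lintegral_congr fun u => by rw [← ENNReal.rpow_mul]
    _ = ∫⁻ h, (∫⁻ u in Ioc (0 : ℝ) 1, increment (2 * p) (velocity f) (u * (1 * h))) *
        kernel Φ p (ℓ / 2) h := by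
        rw [lintegral_lintegral_swap hm2.aemeasurable]
        refine lintegral_congr fun h => ?_
        rw [lintegral_mul_const _ (hm4 h),
          lintegral_lintegral_swap (hm3 h).aemeasurable]
        simp only [one_mul]
        rfl
    _ ≤ _ := by
        refine (lintegral_increment_mul_kernel_le hΦ hp0 hφm hφ hscale one_pos le_rfl
          hv).trans_eq ?_
        rw [ENNReal.ofReal_one, div_one]

/-- A bi-Lipschitz curve of class `W^{1+Ψ,2p}` has finite energy. -/
theorem energy_lt_top {Φ : ℝ → ℝ} {p : ℝ} (hΦ : IsAdmissible Φ p) (hp : 1 ≤ p)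
    (hf : IsArcLengthClosedCurve f) (hW : MemW (psi Φ p) (2 * p) f) (hbi : IsBiLipschitz f) :
    energy Φ p f < ⊤ := by
  have hp0 : 0 < p := by linarith
  obtain ⟨-, g, hg, -, hsemi⟩ := hW
  obtain ⟨A, hA⟩ := exists_energy_le_defectEnergy hΦ hp0 hf hbi
  obtain ⟨φ, hφm, hφ, hscale, -, hfin⟩ := hΦ.scaling
  rw [seminorm_congr_ae (hg.ae_eq (isWeakDeriv_velocity hf))] at hsemi
  have hgag : gagliardo Φ p (velocity f) < ⊤ := by
    rw [← seminorm_rpow_eq_gagliardo hΦ hp (measurable_velocity f)]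
    exact ENNReal.rpow_lt_top_of_nonneg (by positivity) hsemi.ne
  refine hA.trans_lt (ENNReal.mul_lt_top ?_ ((defectEnergy_le_gagliardo hΦ hp hφm hφ hscale
    hf).trans_lt (ENNReal.mul_lt_top (hfin 1 one_pos) hgag)))
  exact ENNReal.rpow_lt_top_of_nonneg hp0.le ENNReal.ofReal_ne_top

end Upper


/-! ### The defect controls the difference of the two end chords -/

section EndChords

/-- If `Q` is almost as long as `x + y`, then the end pieces `a` and `b` of length at most `x`
(with complements of length at most `y`) are both close to `x Q / ‖Q‖`. -/
theorem norm_sub_sq_le_of_norm_le {E : Type*} [NormedAddCommGroup E] [InnerProductSpace ℝ E]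
    {a b Q : E} {x y : ℝ} (ha : ‖a‖ ≤ x) (hb : ‖b‖ ≤ x) (hQa : ‖Q - a‖ ≤ y) (hQb : ‖Q - b‖ ≤ y)
    (hQ : Q ≠ 0) : ‖b - a‖ ^ 2 ≤ 8 * x * (x + y - ‖Q‖) := by
  have hQ0 : 0 < ‖Q‖ := norm_pos_iff.2 hQ
  set e : E := ‖Q‖⁻¹ • Q with he
  have hen : ‖e‖ = 1 := by rw [he, norm_smul, norm_inv, norm_norm, inv_mul_cancel₀ hQ0.ne']
  have hQe : inner ℝ Q e = ‖Q‖ := by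
    rw [he, inner_smul_right, real_inner_self_eq_norm_sq, sq, ← mul_assoc,
      inv_mul_cancel₀ hQ0.ne', one_mul]
  have hx : 0 ≤ x := (norm_nonneg a).trans ha
  have key : ∀ c : E, ‖c‖ ≤ x → ‖Q - c‖ ≤ y → ‖c - x • e‖ ^ 2 ≤ 2 * x * (x + y - ‖Q‖) := by
    intro c hc hQc
    have h1 : inner ℝ (Q - c) e ≤ y := by
      have := real_inner_le_norm (Q - c) e
      rw [hen, mul_one] at this
      exact this.trans hQc
    rw [inner_sub_left, hQe] at h1
    rw [norm_sub_sq_real, norm_smul, hen, inner_smul_right, mul_one, Real.norm_of_nonneg hx]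
    have h2 : ‖c‖ ^ 2 ≤ x ^ 2 := pow_le_pow_left₀ (norm_nonneg c) hc 2
    have h3 := mul_le_mul_of_nonneg_left h1 hx
    linarith
  have h1 := key a ha hQa
  have h2 := key b hb hQb
  have h3 : ‖b - a‖ ≤ ‖b - x • e‖ + ‖a - x • e‖ := by
    have := norm_sub_le (b - x • e) (a - x • e)
    rwa [sub_sub_sub_cancel_right] at this
  have h4 : ‖b - a‖ ^ 2 ≤ (‖b - x • e‖ + ‖a - x • e‖) ^ 2 := pow_le_pow_left₀ (norm_nonneg _) h3 2
  nlinarith [sq_nonneg (‖b - x • e‖ - ‖a - x • e‖)]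

variable {ℓ : ℝ} [hℓ : Fact (0 < ℓ)] {E : Type*} [NormedAddCommGroup E] [NormedSpace ℝ E]

/-- The difference of the mean tangents over the last and over the first `ε`-fraction of the arc
from `s` to `s + h`. -/
def endDiff (f : AddCircle ℓ → E) (ε h : ℝ) (s : AddCircle ℓ) : E :=
  (ε * h)⁻¹ • ((f (s + (h : ℝ)) - f (s + ((h - ε * h : ℝ)))) - (f (s + ((ε * h : ℝ))) - f s))

/-- The difference quotient of `f` with step `ν`. -/
def diffQuot (f : AddCircle ℓ → E) (ν : ℝ) (s : AddCircle ℓ) : E :=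
  ν⁻¹ • (f (s + (ν : ℝ)) - f s)

end EndChords

section EndChordsBound

variable {ℓ : ℝ} [hℓ : Fact (0 < ℓ)] {E : Type*} [NormedAddCommGroup E] [InnerProductSpace ℝ E]
  {f : AddCircle ℓ → E}

theorem norm_endDiff_sq_le (hf : IsArcLengthClosedCurve f) {ε : ℝ} (hε : 0 < ε) (hε1 : ε ≤ 1)
    (s : AddCircle ℓ) {h : ℝ} (hh : h ∈ Ioc (-(ℓ / 2)) (ℓ / 2)) (h0 : h ≠ 0) :
    ‖endDiff f ε h s‖ ^ 2 ≤ 8 / ε * defect f s h := by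
  have hh0 : 0 < |h| := abs_pos.2 h0
  have hεh : |ε * h| = ε * |h| := by rw [abs_mul, abs_of_pos hε]
  have hεh' : |h - ε * h| = (1 - ε) * |h| := by
    rw [← one_sub_mul, abs_mul, abs_of_nonneg (sub_nonneg.2 hε1)]
  have ha := hf.norm_sub_le s (ε * h)
  have hb := hf.norm_sub_le (s + ((h - ε * h : ℝ))) (ε * h)
  have hQa := hf.norm_sub_le (s + ((ε * h : ℝ))) (h - ε * h)
  have hQb := hf.norm_sub_le s (h - ε * h)
  rw [add_assoc, ← AddCircle.coe_add, sub_add_cancel, hεh] at hb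
  rw [add_assoc, ← AddCircle.coe_add, add_sub_cancel, hεh'] at hQa
  rw [hεh] at ha
  rw [hεh'] at hQb
  have hQ : f (s + (h : ℝ)) - f s ≠ 0 := norm_pos_iff.1 (hf.norm_sub_pos s hh h0)
  have := norm_sub_sq_le_of_norm_le ha hb (Q := f (s + (h : ℝ)) - f s)
    (y := (1 - ε) * |h|) (by rwa [sub_sub_sub_cancel_right]) (by rwa [sub_sub_sub_cancel_left]) hQ
  rw [endDiff, norm_smul, mul_pow, norm_inv, Real.norm_eq_abs, hεh, inv_pow,
    inv_mul_le_iff₀ (by positivity)]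
  refine this.trans_eq ?_
  rw [defect]
  field_simp
  ring

theorem enorm_endDiff_rpow_le (hf : IsArcLengthClosedCurve f) {p : ℝ} (hp : 0 ≤ p) {ε : ℝ}
    (hε : 0 < ε) (hε1 : ε ≤ 1) (s : AddCircle ℓ) {h : ℝ} (hh : h ∈ Ioc (-(ℓ / 2)) (ℓ / 2))
    (h0 : h ≠ 0) :
    ‖endDiff f ε h s‖ₑ ^ (2 * p) ≤
      ENNReal.ofReal (8 / ε) ^ p * ENNReal.ofReal (defect f s h) ^ p := by
  rw [ENNReal.rpow_mul, ← ENNReal.mul_rpow_of_nonneg _ _ hp, ← ENNReal.ofReal_mul (by positivity)]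
  refine ENNReal.rpow_le_rpow ?_ hp
  rw [ENNReal.rpow_ofNat, ← ofReal_norm, ← ENNReal.ofReal_pow (norm_nonneg _)]
  exact ENNReal.ofReal_le_ofReal (norm_endDiff_sq_le hf hε hε1 s hh h0)

variable [MeasurableSpace E] [BorelSpace E] [SecondCountableTopology E]

omit hℓ in
theorem measurable_endDiff (hf : Continuous f) (ε : ℝ) :
    Measurable fun z : AddCircle ℓ × ℝ => endDiff f ε z.2 z.1 := by
  have hc : Measurable ((↑) : ℝ → AddCircle ℓ) := AddCircle.measurable_mk'
  have hfm := hf.measurable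
  have h1 : Measurable fun z : AddCircle ℓ × ℝ => f (z.1 + (z.2 : ℝ)) :=
    hfm.comp (measurable_fst.add (hc.comp measurable_snd))
  have h2 : Measurable fun z : AddCircle ℓ × ℝ => f (z.1 + ((z.2 - ε * z.2 : ℝ))) :=
    hfm.comp (measurable_fst.add (hc.comp (measurable_snd.sub (measurable_snd.const_mul ε))))
  have h3 : Measurable fun z : AddCircle ℓ × ℝ => f (z.1 + ((ε * z.2 : ℝ))) :=
    hfm.comp (measurable_fst.add (hc.comp (measurable_snd.const_mul ε)))
  have h4 : Measurable fun z : AddCircle ℓ × ℝ => f z.1 := hfm.comp measurable_fst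
  exact (measurable_snd.const_mul ε).inv.smul ((h1.sub h2).sub (h3.sub h4))

/-- The differences of the end chords are controlled by the model energy. -/
theorem lintegral_endDiff_le {Φ : ℝ → ℝ} {p : ℝ} (hΦ : IsAdmissible Φ p) (hp : 0 ≤ p)
    (hf : IsArcLengthClosedCurve f) (hfc : Continuous f) {ε : ℝ} (hε : 0 < ε) (hε1 : ε ≤ 1) :
    ∫⁻ h, (∫⁻ s : AddCircle ℓ, ‖endDiff f ε h s‖ₑ ^ (2 * p)) * kernel Φ p (ℓ / 2) h ≤
      ENNReal.ofReal (8 / ε) ^ p * defectEnergy Φ p f := by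
  have hK := measurable_kernel (L := ℓ / 2) hΦ
  have hm : Measurable fun z : AddCircle ℓ × ℝ => ‖endDiff f ε z.2 z.1‖ₑ ^ (2 * p) :=
    (measurable_endDiff hfc ε).enorm.pow_const _
  have hm1 : ∀ h : ℝ, Measurable fun s : AddCircle ℓ => ‖endDiff f ε h s‖ₑ ^ (2 * p) := fun h =>
    hm.comp (f := fun s : AddCircle ℓ => (s, h)) (measurable_id.prodMk measurable_const)
  have hm2 : Measurable (Function.uncurry fun (s : AddCircle ℓ) (h : ℝ) =>
      ‖endDiff f ε h s‖ₑ ^ (2 * p) * kernel Φ p (ℓ / 2) h) := hm.mul (hK.comp measurable_snd)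
  have htop : ENNReal.ofReal (8 / ε) ^ p ≠ ⊤ :=
    ENNReal.rpow_ne_top_of_nonneg hp ENNReal.ofReal_ne_top
  calc _ = ∫⁻ s : AddCircle ℓ, ∫⁻ h, ‖endDiff f ε h s‖ₑ ^ (2 * p) * kernel Φ p (ℓ / 2) h := by
        rw [lintegral_lintegral_swap hm2.aemeasurable]
        exact lintegral_congr fun h => (lintegral_mul_const _ (hm1 h)).symm
    _ ≤ _ := by
        rw [defectEnergy, ← lintegral_const_mul' _ _ htop]
        refine lintegral_mono fun s => ?_
        rw [lintegral_mul_kernel, lintegral_mul_kernel, ← lintegral_const_mul' _ _ htop]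
        refine setLIntegral_mono_ae' measurableSet_Ioc ?_
        filter_upwards [Measure.ae_ne volume (0 : ℝ)] with h h0 hh
        rw [← mul_assoc]
        gcongr
        exact enorm_endDiff_rpow_le hf hp hε hε1 s hh h0

end EndChordsBound

/-! ### Increments of the difference quotients -/

section DiffQuot

/-- Both sides are the second mixed difference quotient, with steps `b` and `c`, of an
antiderivative of `F`, so the order of taking the quotient and the mean does not matter. -/
theorem integral_diffQuot_comm {E : Type*} [NormedAddCommGroup E] [NormedSpace ℝ E]
    {F : ℝ → E} (hF : Continuous F) (x : ℝ) {b c : ℝ} (hb : b ≠ 0) (hc : c ≠ 0) :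
    ∫ u in (0 : ℝ)..1, b⁻¹ • (F (x + c * u + b) - F (x + c * u)) =
      ∫ u in (0 : ℝ)..1, c⁻¹ • (F (x + b * u + c) - F (x + b * u)) := by
  have hi : ∀ y z, IntervalIntegrable F volume y z := fun y z => hF.intervalIntegrable y z
  have key : ∀ {b c : ℝ}, b ≠ 0 → c ≠ 0 →
      ∫ u in (0 : ℝ)..1, b⁻¹ • (F (x + c * u + b) - F (x + c * u)) =
      b⁻¹ • c⁻¹ • ((∫ t in x + b..x + b + c, F t) - ∫ t in x..x + c, F t) := by
    intro b c hb hc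
    have e1 : ∫ u in (0 : ℝ)..1, F (x + c * u + b) = c⁻¹ • ∫ t in x + b..x + b + c, F t := by
      have := intervalIntegral.integral_comp_add_mul (a := 0) (b := 1) F hc (x + b)
      simp only [mul_zero, add_zero, mul_one] at this
      rw [← this]
      refine intervalIntegral.integral_congr fun u _ => ?_
      simp only [add_right_comm]
    have e2 : ∫ u in (0 : ℝ)..1, F (x + c * u) = c⁻¹ • ∫ t in x..x + c, F t := by
      have := intervalIntegral.integral_comp_add_mul (a := 0) (b := 1) F hc x
      simpa only [mul_zero, add_zero, mul_one] using this
    rw [intervalIntegral.integral_smul, intervalIntegral.integral_sub, e1, e2, ← smul_sub]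
    · exact Continuous.intervalIntegrable (by fun_prop) _ _
    · exact Continuous.intervalIntegrable (by fun_prop) _ _
  rw [key hb hc, key hc hb, smul_comm]
  congr 2
  rw [← intervalIntegral.integral_add_adjacent_intervals (hi (x + b) (x + c)) (hi (x + c) _),
    ← intervalIntegral.integral_add_adjacent_intervals (hi x (x + b)) (hi (x + b) (x + c)),
    add_right_comm x b c]
  abel

variable {ℓ : ℝ} [hℓ : Fact (0 < ℓ)] {E : Type*} [NormedAddCommGroup E] [NormedSpace ℝ E]
  {f : AddCircle ℓ → E}

omit hℓ in
theorem continuous_diffQuot (hf : Continuous f) (ν : ℝ) : Continuous (diffQuot f ν) := by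
  unfold diffQuot
  fun_prop

omit hℓ in
/-- Averaging `diffQuot f ν` over the two ends of the arc from `s` to `s + h` gives the same as
averaging the mean tangents over translates of these ends by at most `ν`. Hence the increment of
`diffQuot f ν` splits into its deviations from these averages and an average of `endDiff`. -/
theorem diffQuot_sub_eq [CompleteSpace E] (hf : Continuous f) {ν c h : ℝ} (hν : ν ≠ 0)
    {ε : ℝ} (hc : c ≠ 0) (hch : c = ε * h) (s : AddCircle ℓ) :
    diffQuot f ν (s + (h : ℝ)) - diffQuot f ν s =
      (∫ u in (0 : ℝ)..1, (diffQuot f ν (s + (h : ℝ)) - diffQuot f ν (s + ((h - u * c : ℝ))))) +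
      (∫ y in (0 : ℝ)..1, endDiff f ε h (s + ((y * ν : ℝ)))) +
      ∫ u in (0 : ℝ)..1, (diffQuot f ν (s + ((u * c : ℝ))) - diffQuot f ν s) := by
  obtain ⟨t, rfl⟩ := QuotientAddGroup.mk_surjective s
  have hcoe : Continuous ((↑) : ℝ → AddCircle ℓ) := AddCircle.continuous_mk' ℓ
  set F := lift f with hF
  have hFc : Continuous F := hf.comp hcoe
  have hlift : ∀ x : ℝ, f (x : AddCircle ℓ) = F x := fun x => rfl
  have hG : ∀ x : ℝ, diffQuot f ν (x : AddCircle ℓ) = ν⁻¹ • (F (x + ν) - F x) := fun x => by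
    rw [diffQuot, ← AddCircle.coe_add, hlift, hlift]
  have hmk : (QuotientAddGroup.mk t : AddCircle ℓ) = (t : AddCircle ℓ) := rfl
  have h1 : ∫ u in (0 : ℝ)..1, diffQuot f ν ((t : AddCircle ℓ) + ((h - u * c : ℝ))) =
      ∫ y in (0 : ℝ)..1, c⁻¹ • (F (t + h + ν * y) - F (t + h + ν * y - c)) := by
    have := integral_diffQuot_comm hFc (t + h) hν (neg_ne_zero.2 hc)
    calc _ = ∫ u in (0 : ℝ)..1, ν⁻¹ • (F (t + h + -c * u + ν) - F (t + h + -c * u)) := by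
          refine intervalIntegral.integral_congr fun u _ => ?_
          rw [← AddCircle.coe_add, hG, show t + (h - u * c) = t + h + -c * u by ring]
      _ = _ := by
          rw [this]
          refine intervalIntegral.integral_congr fun u _ => ?_
          rw [inv_neg, neg_smul, ← smul_neg, neg_sub, sub_eq_add_neg _ c]
  have h2 : ∫ u in (0 : ℝ)..1, diffQuot f ν ((t : AddCircle ℓ) + ((u * c : ℝ))) =
      ∫ y in (0 : ℝ)..1, c⁻¹ • (F (t + ν * y + c) - F (t + ν * y)) := by
    rw [← integral_diffQuot_comm hFc t hν hc]
    refine intervalIntegral.integral_congr fun u _ => ?_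
    rw [← AddCircle.coe_add, hG, mul_comm u c]
  have h3 : ∫ y in (0 : ℝ)..1, endDiff f ε h ((t : AddCircle ℓ) + ((y * ν : ℝ))) =
      (∫ y in (0 : ℝ)..1, c⁻¹ • (F (t + h + ν * y) - F (t + h + ν * y - c))) -
      ∫ y in (0 : ℝ)..1, c⁻¹ • (F (t + ν * y + c) - F (t + ν * y)) := by
    rw [← intervalIntegral.integral_sub]
    · refine intervalIntegral.integral_congr fun y _ => ?_
      simp only [endDiff]
      rw [← smul_sub, ← hch]
      simp only [← AddCircle.coe_add, hlift]
      rw [show t + y * ν + h = t + h + ν * y by ring,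
        show t + y * ν + (h - c) = t + h + ν * y - c by ring, mul_comm y ν]
    · exact Continuous.intervalIntegrable (by fun_prop) _ _
    · exact Continuous.intervalIntegrable (by fun_prop) _ _
  have hq := continuous_diffQuot hf ν
  rw [hmk, intervalIntegral.integral_sub, intervalIntegral.integral_sub, h1, h2, h3]
  · simp
  · exact Continuous.intervalIntegrable (by fun_prop) _ _
  · exact intervalIntegrable_const
  · exact intervalIntegrable_const
  · exact Continuous.intervalIntegrable (by fun_prop) _ _

theorem add_add_rpow_le (a b c : ℝ≥0∞) {q : ℝ} (hq : 0 ≤ q) :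
    (a + b + c) ^ q ≤ 3 ^ q * (a ^ q + b ^ q + c ^ q) := by
  have key : ∀ m : ℝ≥0∞, a ≤ m → b ≤ m → c ≤ m → m ^ q ≤ a ^ q + b ^ q + c ^ q →
      (a + b + c) ^ q ≤ 3 ^ q * (a ^ q + b ^ q + c ^ q) := by
    intro m ha hb hc hm
    calc (a + b + c) ^ q ≤ (3 * m) ^ q := by
          refine ENNReal.rpow_le_rpow ?_ hq
          calc a + b + c ≤ m + m + m := by gcongr
            _ = 3 * m := by ring
      _ = 3 ^ q * m ^ q := ENNReal.mul_rpow_of_nonneg _ _ hq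
      _ ≤ _ := by gcongr
  rcases le_total a b with hab | hab
  · rcases le_total b c with hbc | hbc
    · exact key c (hab.trans hbc) hbc le_rfl le_add_self
    · exact key b hab le_rfl hbc (le_add_self.trans le_self_add)
  · rcases le_total a c with hac | hac
    · exact key c hac (hab.trans hac) le_rfl le_add_self
    · exact key a le_rfl hab hac (le_self_add.trans le_self_add)

theorem enorm_intervalIntegral_rpow_le {q : ℝ} (hq : 1 ≤ q) {G : ℝ → E} (hG : Continuous G) :
    ‖∫ u in (0 : ℝ)..1, G u‖ₑ ^ q ≤ ∫⁻ u in Ioc (0 : ℝ) 1, ‖G u‖ₑ ^ q := by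
  rw [intervalIntegral.integral_of_le zero_le_one]
  exact (ENNReal.rpow_le_rpow (enorm_integral_le_lintegral_enorm _) (by linarith)).trans
    (rpow_lintegral_le hq hG.enorm.aemeasurable)

omit hℓ in
theorem enorm_diffQuot_sub_rpow_le [CompleteSpace E] (hf : Continuous f) {ν : ℝ} (hν : ν ≠ 0)
    {q : ℝ} (hq : 1 ≤ q) {ε h : ℝ} (hε : ε ≠ 0) (h0 : h ≠ 0) (s : AddCircle ℓ) :
    ‖diffQuot f ν (s + (h : ℝ)) - diffQuot f ν s‖ₑ ^ q ≤ 3 ^ q *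
      ((∫⁻ u in Ioc (0 : ℝ) 1,
        ‖diffQuot f ν (s + (h : ℝ)) - diffQuot f ν (s + ((h - u * (ε * h) : ℝ)))‖ₑ ^ q) +
      (∫⁻ y in Ioc (0 : ℝ) 1, ‖endDiff f ε h (s + ((y * ν : ℝ)))‖ₑ ^ q) +
      ∫⁻ u in Ioc (0 : ℝ) 1, ‖diffQuot f ν (s + ((u * (ε * h) : ℝ))) - diffQuot f ν s‖ₑ ^ q) := by
  have hcoe : Continuous ((↑) : ℝ → AddCircle ℓ) := AddCircle.continuous_mk' ℓ
  have hqc := continuous_diffQuot hf ν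
  have hec : Continuous (endDiff f ε h) := by unfold endDiff; fun_prop
  rw [diffQuot_sub_eq hf hν (mul_ne_zero hε h0) rfl s]
  refine (ENNReal.rpow_le_rpow ((enorm_add_le _ _).trans (add_le_add_left (enorm_add_le _ _) _))
    (by linarith)).trans ?_
  refine (add_add_rpow_le _ _ _ (by linarith)).trans ?_
  gcongr
  · exact enorm_intervalIntegral_rpow_le hq (by fun_prop)
  · exact enorm_intervalIntegral_rpow_le hq (by fun_prop)
  · exact enorm_intervalIntegral_rpow_le hq (by fun_prop)

/-- The increments of the difference quotient with step `ν`, in terms of its own rescaled increments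
and of the end chords of `f`. Translation invariance removes the dependence on `ν` of the latter. -/
theorem increment_diffQuot_le [CompleteSpace E] (hf : Continuous f) {ν : ℝ} (hν : ν ≠ 0)
    {q : ℝ} (hq : 1 ≤ q) {ε h : ℝ} (hε : ε ≠ 0) (h0 : h ≠ 0) :
    increment q (diffQuot f ν) h ≤ 3 ^ q *
      (2 * (∫⁻ u in Ioc (0 : ℝ) 1, increment q (diffQuot f ν) (u * (ε * h))) +
        ∫⁻ s : AddCircle ℓ, ‖endDiff f ε h s‖ₑ ^ q) := by
  have hcoe : Continuous ((↑) : ℝ → AddCircle ℓ) := AddCircle.continuous_mk' ℓ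
  have hqc := continuous_diffQuot hf ν
  have hec : Continuous (endDiff f ε h) := by unfold endDiff; fun_prop
  have htop : (3 : ℝ≥0∞) ^ q ≠ ⊤ := ENNReal.rpow_ne_top_of_nonneg (by linarith) (by simp)
  have hm1 : Measurable (Function.uncurry fun (s : AddCircle ℓ) (u : ℝ) =>
      ‖diffQuot f ν (s + (h : ℝ)) - diffQuot f ν (s + ((h - u * (ε * h) : ℝ)))‖ₑ ^ q) := by
    refine Measurable.pow_const (Continuous.measurable ?_) q
    fun_prop
  have hm2 : Measurable (Function.uncurry fun (s : AddCircle ℓ) (y : ℝ) =>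
      ‖endDiff f ε h (s + ((y * ν : ℝ)))‖ₑ ^ q) := by
    refine Measurable.pow_const (Continuous.measurable ?_) q
    fun_prop
  have hm3 : Measurable (Function.uncurry fun (s : AddCircle ℓ) (u : ℝ) =>
      ‖diffQuot f ν (s + ((u * (ε * h) : ℝ))) - diffQuot f ν s‖ₑ ^ q) := by
    refine Measurable.pow_const (Continuous.measurable ?_) q
    fun_prop
  have e1 : ∫⁻ s : AddCircle ℓ, ∫⁻ u in Ioc (0 : ℝ) 1,
      ‖diffQuot f ν (s + (h : ℝ)) - diffQuot f ν (s + ((h - u * (ε * h) : ℝ)))‖ₑ ^ q =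
      ∫⁻ u in Ioc (0 : ℝ) 1, increment q (diffQuot f ν) (u * (ε * h)) := by
    rw [lintegral_lintegral_swap hm1.aemeasurable]
    refine lintegral_congr fun u => ?_
    refine Eq.trans (lintegral_congr fun s => ?_) (lintegral_add_right_eq_self
      (fun s => ‖diffQuot f ν (s + ((u * (ε * h) : ℝ))) - diffQuot f ν s‖ₑ ^ q)
      ((h - u * (ε * h) : ℝ) : AddCircle ℓ))
    rw [add_assoc s, ← AddCircle.coe_add, sub_add_cancel]
  have e2 : ∫⁻ s : AddCircle ℓ, ∫⁻ y in Ioc (0 : ℝ) 1, ‖endDiff f ε h (s + ((y * ν : ℝ)))‖ₑ ^ q =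
      ∫⁻ s : AddCircle ℓ, ‖endDiff f ε h s‖ₑ ^ q := by
    rw [lintegral_lintegral_swap hm2.aemeasurable]
    have : ∀ y : ℝ, ∫⁻ s : AddCircle ℓ, ‖endDiff f ε h (s + ((y * ν : ℝ)))‖ₑ ^ q =
        ∫⁻ s : AddCircle ℓ, ‖endDiff f ε h s‖ₑ ^ q := fun y =>
      lintegral_add_right_eq_self (fun s => ‖endDiff f ε h s‖ₑ ^ q) _
    simp [this]
  have e3 : ∫⁻ s : AddCircle ℓ, ∫⁻ u in Ioc (0 : ℝ) 1,
      ‖diffQuot f ν (s + ((u * (ε * h) : ℝ))) - diffQuot f ν s‖ₑ ^ q =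
      ∫⁻ u in Ioc (0 : ℝ) 1, increment q (diffQuot f ν) (u * (ε * h)) := by
    rw [lintegral_lintegral_swap hm3.aemeasurable]
    rfl
  calc _ ≤ _ := lintegral_mono fun s => enorm_diffQuot_sub_rpow_le hf hν hq hε h0 s
    _ = _ := by
        rw [lintegral_const_mul' _ _ htop, lintegral_add_left, lintegral_add_left, e1, e2, e3]
        · ring
        · exact hm1.lintegral_prod_right'
        · exact hm1.lintegral_prod_right'.add hm2.lintegral_prod_right'

end DiffQuot


/-! ### Finite energy gives Sobolev regularity -/

section Lower

variable {ℓ : ℝ} [hℓ : Fact (0 < ℓ)]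

section Finite

variable {E : Type*} [NormedAddCommGroup E] [NormedSpace ℝ E] {f : AddCircle ℓ → E}

theorem norm_diffQuot_sub_le (hf : IsArcLengthClosedCurve f) {ν : ℝ} (hν : 0 < ν)
    (s : AddCircle ℓ) (h : ℝ) :
    ‖diffQuot f ν (s + (h : ℝ)) - diffQuot f ν s‖ ≤ 2 / ν * |h| := by
  have h1 := hf.norm_sub_le s h
  have h2 := hf.norm_sub_le (s + (ν : ℝ)) h
  rw [diffQuot, diffQuot, ← smul_sub, norm_smul, norm_inv, Real.norm_of_nonneg hν.le,
    sub_sub_sub_comm, add_right_comm s (h : AddCircle ℓ)]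
  calc _ ≤ ν⁻¹ * (|h| + |h|) := by
        gcongr
        exact (norm_sub_le _ _).trans (add_le_add h2 h1)
    _ = _ := by ring

theorem lintegral_Ioc_comp_abs_le (G : ℝ → ℝ≥0∞) (L : ℝ) (hG : Measurable fun h => G |h|) :
    ∫⁻ h in Ioc (-L) L, G |h| ≤ 2 * ∫⁻ h in Ioc 0 L, G h := by
  have h1 : ∫⁻ h in Ioc 0 L, G h = ∫⁻ h, (Ioc 0 L).indicator (fun h => G |h|) h := by
    rw [lintegral_indicator measurableSet_Ioc]
    exact setLIntegral_congr_fun measurableSet_Ioc fun h hh => by rw [abs_of_pos hh.1]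
  have hm : Measurable ((Ioc 0 L).indicator fun h => G |h|) := hG.indicator measurableSet_Ioc
  have h2 : ∫⁻ h, (Ioc 0 L).indicator (fun h => G |h|) (-h) =
      ∫⁻ h, (Ioc 0 L).indicator (fun h => G |h|) h := lintegral_neg_eq_self _
  rw [two_mul, h1]
  nth_rw 2 [← h2]
  rw [← lintegral_add_left hm, ← lintegral_indicator measurableSet_Ioc]
  refine lintegral_mono_ae ?_
  filter_upwards [Measure.ae_ne volume (0 : ℝ), Measure.ae_ne volume (-L)] with h h0 hL
  by_cases hh : h ∈ Ioc (-L) L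
  · rw [indicator_of_mem hh]
    rcases lt_or_gt_of_ne h0 with hneg | hpos
    · have : -h ∈ Ioc 0 L := ⟨by linarith, by linarith [hh.1]⟩
      rw [indicator_of_mem this, abs_neg]
      exact le_add_self
    · have : h ∈ Ioc 0 L := ⟨hpos, hh.2⟩
      rw [indicator_of_mem this]
      exact le_self_add
  · rw [indicator_of_notMem hh]
    exact zero_le

/-- Difference quotients of `f` are Lipschitz, so the integrability of `t^(2p) / Φ(t)^p` makes their
Gagliardo functional finite. -/
theorem gagliardo_diffQuot_lt_top {Φ : ℝ → ℝ} {p : ℝ} (hΦ : IsAdmissible Φ p) (hp : 0 < p)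
    (hf : IsArcLengthClosedCurve f) {ν : ℝ} (hν : 0 < ν) :
    gagliardo Φ p (diffQuot f ν) < ⊤ := by
  have hc : ENNReal.ofReal (2 / ν) ^ (2 * p) ≠ ⊤ :=
    ENNReal.rpow_ne_top_of_nonneg (by positivity) ENNReal.ofReal_ne_top
  have hinc : ∀ h : ℝ, increment (2 * p) (diffQuot f ν) h ≤
      ENNReal.ofReal (2 / ν) ^ (2 * p) * ENNReal.ofReal ℓ * ENNReal.ofReal |h| ^ (2 * p) := by
    intro h
    calc increment (2 * p) (diffQuot f ν) h ≤ ∫⁻ _ : AddCircle ℓ,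
          ENNReal.ofReal (2 / ν * |h|) ^ (2 * p) := by
          refine lintegral_mono fun s => ENNReal.rpow_le_rpow ?_ (by positivity)
          rw [← ofReal_norm]
          exact ENNReal.ofReal_le_ofReal (norm_diffQuot_sub_le hf hν s h)
      _ = _ := by
          rw [lintegral_const, AddCircle.measure_univ, ENNReal.ofReal_mul (by positivity),
            ENNReal.mul_rpow_of_nonneg _ _ (by positivity)]
          ring
  have hm : Measurable fun h : ℝ =>
      ENNReal.ofReal |h| ^ (2 * p) * (ENNReal.ofReal (Φ |h|))⁻¹ ^ p :=
    (measurable_norm.ennreal_ofReal.pow_const _).mul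
      (hΦ.measurable_comp_abs.ennreal_ofReal.inv.pow_const _)
  have hfin : ∫⁻ h in Ioc 0 (ℓ / 2),
      ENNReal.ofReal h ^ (2 * p) * (ENNReal.ofReal (Φ h))⁻¹ ^ p < ⊤ := by
    refine (hΦ.integral_lt_top (ℓ / 2) (half_pos hℓ.out)).trans_le' (le_of_eq ?_)
    refine setLIntegral_congr_fun measurableSet_Ioc fun h hh => ?_
    have hΦh := hΦ.pos hh.1
    rw [ENNReal.ofReal_div_of_pos (by positivity), ENNReal.inv_rpow, div_eq_mul_inv,
      ENNReal.ofReal_rpow_of_nonneg hh.1.le (by positivity),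
      ENNReal.ofReal_rpow_of_nonneg hΦh.le hp.le]
  calc gagliardo Φ p (diffQuot f ν) ≤ ∫⁻ h, (ENNReal.ofReal (2 / ν) ^ (2 * p) *
        ENNReal.ofReal ℓ) * (ENNReal.ofReal |h| ^ (2 * p) * kernel Φ p (ℓ / 2) h) := by
        refine lintegral_mono fun h => ?_
        rw [← mul_assoc]
        exact mul_le_mul_left (hinc h) _
    _ = (ENNReal.ofReal (2 / ν) ^ (2 * p) * ENNReal.ofReal ℓ) *
        ∫⁻ h in Ioc (-(ℓ / 2)) (ℓ / 2),
          ENNReal.ofReal |h| ^ (2 * p) * (ENNReal.ofReal (Φ |h|))⁻¹ ^ p := by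
        rw [lintegral_const_mul' _ _ (ENNReal.mul_ne_top hc ENNReal.ofReal_ne_top),
          lintegral_mul_kernel]
    _ ≤ (ENNReal.ofReal (2 / ν) ^ (2 * p) * ENNReal.ofReal ℓ) *
        (2 * ∫⁻ h in Ioc 0 (ℓ / 2),
          ENNReal.ofReal h ^ (2 * p) * (ENNReal.ofReal (Φ h))⁻¹ ^ p) := by
        gcongr
        exact lintegral_Ioc_comp_abs_le
          (fun h => ENNReal.ofReal h ^ (2 * p) * (ENNReal.ofReal (Φ h))⁻¹ ^ p) _ hm
    _ < ⊤ := ENNReal.mul_lt_top (ENNReal.mul_lt_top hc.lt_top ENNReal.ofReal_lt_top)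
        (ENNReal.mul_lt_top (by simp) hfin)

/-- The `L^q` norm of the velocity is at most `ℓ^(1/q)`, so its `q`-th power is controlled by the
norm itself. -/
theorem eLpNorm_velocity_rpow_le (hf : IsArcLengthClosedCurve f) {q : ℝ} (hq : 1 ≤ q) :
    eLpNorm (velocity f) (ENNReal.ofReal q) volume ^ q ≤
      (ENNReal.ofReal ℓ ^ q⁻¹) ^ (q - 1) * eLpNorm (velocity f) (ENNReal.ofReal q) volume := by
  have hN : eLpNorm (velocity f) (ENNReal.ofReal q) volume ≤ ENNReal.ofReal ℓ ^ q⁻¹ := by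
    have := eLpNorm_le_of_ae_bound (p := ENNReal.ofReal q) (μ := (volume : Measure (AddCircle ℓ)))
      (Eventually.of_forall (norm_velocity_le hf))
    rwa [AddCircle.measure_univ, ENNReal.toReal_ofReal (by linarith), ENNReal.ofReal_one,
      mul_one] at this
  calc _ = eLpNorm (velocity f) (ENNReal.ofReal q) volume ^ (q - 1) *
        eLpNorm (velocity f) (ENNReal.ofReal q) volume := by
        conv_rhs => rw [← ENNReal.rpow_one (eLpNorm (velocity f) (ENNReal.ofReal q) volume),
          ← ENNReal.rpow_mul, one_mul]
        rw [← ENNReal.rpow_add_of_nonneg _ _ (by linarith) zero_le_one, sub_add_cancel]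
    _ ≤ _ := by gcongr

end Finite

variable {E : Type*} [NormedAddCommGroup E] [InnerProductSpace ℝ E] [CompleteSpace E]
  [MeasurableSpace E] [BorelSpace E] [SecondCountableTopology E] {f : AddCircle ℓ → E}

/-- The inequality to be absorbed, for the difference quotients of `f`. -/
theorem gagliardo_diffQuot_le_add {Φ : ℝ → ℝ} {p : ℝ} (hΦ : IsAdmissible Φ p) (hp : 1 ≤ p)
    {φ : ℝ → ℝ} (hφm : Measurable φ) (hφ : ∀ k, 0 ≤ k → 0 ≤ φ k)
    (hscale : ∀ k x, 0 ≤ k → 0 ≤ x → Φ (k * x) ≤ φ k * Φ x) (hf : IsArcLengthClosedCurve f)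
    (hfc : Continuous f) {ε : ℝ} (hε : 0 < ε) (hε1 : ε ≤ 1) {ν : ℝ} (hν : 0 < ν) :
    gagliardo Φ p (diffQuot f ν) ≤ 3 ^ (2 * p) *
      (2 * (scalingIntegral φ p ε / ENNReal.ofReal ε * gagliardo Φ p (diffQuot f ν)) +
        ENNReal.ofReal (8 / ε) ^ p * defectEnergy Φ p f) := by
  have hp0 : 0 ≤ p := by linarith
  have hK := measurable_kernel (L := ℓ / 2) hΦ
  have hg : Measurable (diffQuot f ν) := (continuous_diffQuot hfc ν).measurable
  have htop : (3 : ℝ≥0∞) ^ (2 * p) ≠ ⊤ := ENNReal.rpow_ne_top_of_nonneg (by linarith) (by simp)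
  have hm : Measurable fun z : ℝ × ℝ => increment (2 * p) (diffQuot f ν) (z.2 * (ε * z.1)) :=
    (measurable_increment hg).comp (measurable_snd.mul (measurable_fst.const_mul ε))
  have hm1 : Measurable fun h : ℝ => (∫⁻ u in Ioc (0 : ℝ) 1,
      increment (2 * p) (diffQuot f ν) (u * (ε * h))) * kernel Φ p (ℓ / 2) h :=
    (Measurable.lintegral_prod_right' (f := fun z : ℝ × ℝ =>
      increment (2 * p) (diffQuot f ν) (z.2 * (ε * z.1))) hm).mul hK
  calc gagliardo Φ p (diffQuot f ν) ≤ ∫⁻ h, 3 ^ (2 * p) *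
        (2 * ((∫⁻ u in Ioc (0 : ℝ) 1, increment (2 * p) (diffQuot f ν) (u * (ε * h))) *
          kernel Φ p (ℓ / 2) h) +
        (∫⁻ s : AddCircle ℓ, ‖endDiff f ε h s‖ₑ ^ (2 * p)) * kernel Φ p (ℓ / 2) h) := by
        refine lintegral_mono_ae ?_
        filter_upwards [Measure.ae_ne volume (0 : ℝ)] with h h0
        refine (mul_le_mul_left (increment_diffQuot_le hfc hν.ne' (q := 2 * p) (by linarith)
          hε.ne' h0) _).trans_eq ?_
        ring
    _ = 3 ^ (2 * p) * (2 * (∫⁻ h, (∫⁻ u in Ioc (0 : ℝ) 1,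
          increment (2 * p) (diffQuot f ν) (u * (ε * h))) * kernel Φ p (ℓ / 2) h) +
        ∫⁻ h, (∫⁻ s : AddCircle ℓ, ‖endDiff f ε h s‖ₑ ^ (2 * p)) * kernel Φ p (ℓ / 2) h) := by
        rw [lintegral_const_mul' _ _ htop, lintegral_add_left (hm1.const_mul 2),
          lintegral_const_mul' _ _ (by simp)]
    _ ≤ _ := by
        gcongr
        · exact lintegral_increment_mul_kernel_le hΦ hp0 hφm hφ hscale hε hε1 hg
        · exact lintegral_endDiff_le hΦ hp0 hf hfc hε hε1

theorem le_two_mul_of_le_half_add {X c B : ℝ≥0∞} (hX : X < ⊤) (hc : c ≤ 2⁻¹) (h : X ≤ c * X + B) :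
    X ≤ 2 * B := by
  have h1 : X ≤ 2⁻¹ * X + B := h.trans (by gcongr)
  have h2 : (2⁻¹ : ℝ≥0∞) * X ≠ ⊤ := ENNReal.mul_ne_top (by simp) hX.ne
  have h3 : 2⁻¹ * X + 2⁻¹ * X ≤ 2⁻¹ * X + B := by
    rwa [← add_mul, ENNReal.inv_two_add_inv_two, one_mul]
  have h4 : 2⁻¹ * X ≤ B := (ENNReal.add_le_add_iff_left h2).1 h3
  calc X = 2 * (2⁻¹ * X) := by
        rw [← mul_assoc, ENNReal.mul_inv_cancel (by simp) (by simp), one_mul]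
    _ ≤ 2 * B := by gcongr

/-- The bound for the difference quotients, uniform in the step `ν`: for small `ε` the condition
`M(ε) = o(ε)` allows to absorb the Gagliardo term on the right, which is finite beforehand because
difference quotients are Lipschitz. -/
theorem exists_gagliardo_diffQuot_le {Φ : ℝ → ℝ} {p : ℝ} (hΦ : IsAdmissible Φ p) (hp : 1 ≤ p)
    (ℓ : ℝ) [Fact (0 < ℓ)] :
    ∃ C : ℝ≥0∞, C ≠ ⊤ ∧ ∀ {E : Type} [NormedAddCommGroup E] [InnerProductSpace ℝ E]
      [CompleteSpace E] [MeasurableSpace E] [BorelSpace E] [SecondCountableTopology E]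
      {f : AddCircle ℓ → E}, IsArcLengthClosedCurve f → ∀ {ν : ℝ}, 0 < ν →
      gagliardo Φ p (diffQuot f ν) ≤ C * energy Φ p f := by
  have hp0 : 0 < p := by linarith
  obtain ⟨φ, hφm, hφ, hscale, hlim, -⟩ := hΦ.scaling
  obtain ⟨κ, hκ, hκE⟩ := exists_defectEnergy_le_energy hΦ hp0.le ℓ
  have htop : (3 : ℝ≥0∞) ^ (2 * p) ≠ ⊤ := ENNReal.rpow_ne_top_of_nonneg (by linarith) (by simp)
  -- With this threshold the coefficient of the Gagliardo term is at most `1 / 2`.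
  have hthr : (0 : ℝ≥0∞) < (2 * (3 ^ (2 * p) * 2))⁻¹ := by
    rw [ENNReal.inv_pos]
    exact ENNReal.mul_ne_top (by simp) (ENNReal.mul_ne_top htop (by simp))
  obtain ⟨ε, hεM, hε, hε1⟩ : ∃ ε : ℝ,
      scalingIntegral φ p ε / ENNReal.ofReal ε < (2 * (3 ^ (2 * p) * 2))⁻¹ ∧ 0 < ε ∧ ε < 1 := by
    have h1 := hlim.eventually (gt_mem_nhds hthr)
    have h2 : Ioo (0 : ℝ) 1 ∈ 𝓝[>] 0 := Ioo_mem_nhdsGT one_pos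
    obtain ⟨ε, h3, h4⟩ := (h1.and h2).exists
    exact ⟨ε, h3, h4.1, h4.2⟩
  have hκ0 : ENNReal.ofReal κ ^ p ≠ 0 := by
    rw [Ne, ENNReal.rpow_eq_zero_iff]
    simp [hκ]
  have hκtop : ENNReal.ofReal κ ^ p ≠ ⊤ :=
    ENNReal.rpow_ne_top_of_nonneg hp0.le ENNReal.ofReal_ne_top
  refine ⟨2 * (3 ^ (2 * p) * (ENNReal.ofReal (8 / ε) ^ p * (ENNReal.ofReal κ ^ p)⁻¹)), ?_, ?_⟩
  · refine ENNReal.mul_ne_top (by simp) (ENNReal.mul_ne_top htop (ENNReal.mul_ne_top ?_ ?_))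
    · exact ENNReal.rpow_ne_top_of_nonneg hp0.le ENNReal.ofReal_ne_top
    · exact ENNReal.inv_ne_top.2 hκ0
  · intro E _ _ _ _ _ _ f hf ν hν
    obtain ⟨K, hK⟩ := hf.lipschitz
    have h1 := gagliardo_diffQuot_le_add hΦ hp hφm hφ hscale hf hK.continuous hε hε1.le hν
    have hc : 3 ^ (2 * p) * 2 * (scalingIntegral φ p ε / ENNReal.ofReal ε) ≤ (2 : ℝ≥0∞)⁻¹ := by
      have h0 : (3 : ℝ≥0∞) ^ (2 * p) * 2 ≠ 0 := by simp
      have ht : (3 : ℝ≥0∞) ^ (2 * p) * 2 ≠ ⊤ := ENNReal.mul_ne_top htop (by simp)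
      calc _ ≤ (3 : ℝ≥0∞) ^ (2 * p) * 2 * (2 * (3 ^ (2 * p) * 2))⁻¹ := by gcongr
        _ = _ := by
          rw [ENNReal.mul_inv (Or.inl (by simp)) (Or.inl (by simp)), mul_left_comm,
            ENNReal.mul_inv_cancel h0 ht, mul_one]
    have h2 := le_two_mul_of_le_half_add (gagliardo_diffQuot_lt_top hΦ hp0 hf hν) hc
      (B := 3 ^ (2 * p) * (ENNReal.ofReal (8 / ε) ^ p * defectEnergy Φ p f)) (by
        refine h1.trans_eq ?_
        ring)
    have h3 : defectEnergy Φ p f ≤ (ENNReal.ofReal κ ^ p)⁻¹ * energy Φ p f := by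
      have := hκE hf
      rwa [mul_comm, ← ENNReal.le_div_iff_mul_le (Or.inl hκ0) (Or.inl hκtop),
        div_eq_mul_inv, mul_comm] at this
    refine h2.trans ?_
    calc _ ≤ 2 * (3 ^ (2 * p) * (ENNReal.ofReal (8 / ε) ^ p *
          ((ENNReal.ofReal κ ^ p)⁻¹ * energy Φ p f))) := by gcongr
      _ = _ := by ring

end Lower

section Limit

variable {ℓ : ℝ} [hℓ : Fact (0 < ℓ)] {E : Type*} [NormedAddCommGroup E] [InnerProductSpace ℝ E]
  [FiniteDimensional ℝ E] [MeasurableSpace E] [BorelSpace E] [SecondCountableTopology E]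
  {f : AddCircle ℓ → E}

theorem ae_tendsto_diffQuot (hf : IsArcLengthClosedCurve f) (hfc : Continuous f) {ν : ℕ → ℝ}
    (hν : Tendsto ν atTop (𝓝[>] 0)) :
    ∀ᵐ s, Tendsto (fun n => diffQuot f (ν n) s) atTop (𝓝 (velocity f s)) := by
  have hmeas : MeasurableSet
      {s : AddCircle ℓ | Tendsto (fun n => diffQuot f (ν n) s) atTop (𝓝 (velocity f s))} :=
    measurableSet_tendsto_fun (fun n => (continuous_diffQuot hfc (ν n)).measurable)
      (measurable_velocity f)
  rw [← (AddCircle.measurePreserving_mk ℓ 0).map_eq,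
    ae_map_iff AddCircle.measurable_mk'.aemeasurable hmeas]
  refine ae_restrict_of_ae ?_
  filter_upwards [hf.lipschitzWith_lift.ae_differentiableAt_real] with t ht
  have h1 := ht.hasDerivAt.tendsto_slope_zero_right.comp hν
  rw [velocity_coe]
  exact h1

/-- Passage to the limit `ν → 0` by Fatou's lemma. -/
theorem gagliardo_velocity_le {Φ : ℝ → ℝ} {p : ℝ} (hΦ : IsAdmissible Φ p) (hp : 0 < p)
    (hf : IsArcLengthClosedCurve f) {B : ℝ≥0∞}
    (hB : ∀ ν : ℝ, 0 < ν → gagliardo Φ p (diffQuot f ν) ≤ B) :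
    gagliardo Φ p (velocity f) ≤ B := by
  obtain ⟨K, hK⟩ := hf.lipschitz
  have hfc := hK.continuous
  set ν : ℕ → ℝ := fun n => 1 / ((n : ℝ) + 1) with hνdef
  have hνpos : ∀ n, 0 < ν n := fun n => by positivity
  have hν : Tendsto ν atTop (𝓝[>] 0) :=
    tendsto_nhdsWithin_iff.2 ⟨tendsto_one_div_add_atTop_nhds_zero_nat, Eventually.of_forall hνpos⟩
  have hae := ae_tendsto_diffQuot hf hfc hν
  have hKm := measurable_kernel (L := ℓ / 2) hΦ
  have hgm : ∀ n, Measurable (diffQuot f (ν n)) := fun n =>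
    (continuous_diffQuot hfc (ν n)).measurable
  have hsm : ∀ {g : AddCircle ℓ → E}, Measurable g → ∀ h : ℝ,
      Measurable fun s : AddCircle ℓ => ‖g (s + (h : ℝ)) - g s‖ₑ ^ (2 * p) := fun hg h =>
    (measurable_increment_integrand hg).comp (f := fun s : AddCircle ℓ => (s, h))
      (measurable_id.prodMk measurable_const)
  have hmul : ∀ {g : AddCircle ℓ → E}, Measurable g → ∀ (h : ℝ) (k : ℝ≥0∞),
      ∫⁻ s : AddCircle ℓ, ‖g (s + (h : ℝ)) - g s‖ₑ ^ (2 * p) * k =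
        increment (2 * p) g h * k := fun hg h k => by
    rw [increment, lintegral_mul_const _ (hsm hg h)]
  have hfatou : ∀ h : ℝ, h ≠ 0 → increment (2 * p) (velocity f) h * kernel Φ p (ℓ / 2) h ≤
      liminf (fun n => increment (2 * p) (diffQuot f (ν n)) h * kernel Φ p (ℓ / 2) h) atTop := by
    intro h h0
    have hk : kernel Φ p (ℓ / 2) h ≠ ⊤ := by
      rw [kernel, indicator_apply]
      split_ifs
      · refine ENNReal.rpow_ne_top_of_nonneg hp.le (ENNReal.inv_ne_top.2 ?_)
        simpa using hΦ.pos (abs_pos.2 h0)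
      · simp
    have hshift : ∀ᵐ s : AddCircle ℓ, Tendsto (fun n => diffQuot f (ν n) (s + (h : ℝ))) atTop
        (𝓝 (velocity f (s + (h : ℝ)))) := by
      have hq := (measurePreserving_add_right (volume : Measure (AddCircle ℓ))
        (h : AddCircle ℓ)).quasiMeasurePreserving
      exact hq.ae (p := fun s => Tendsto (fun n => diffQuot f (ν n) s) atTop
        (𝓝 (velocity f s))) hae
    have hlim : ∀ᵐ s : AddCircle ℓ,
        liminf (fun n => ‖diffQuot f (ν n) (s + (h : ℝ)) - diffQuot f (ν n) s‖ₑ ^ (2 * p) *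
          kernel Φ p (ℓ / 2) h) atTop =
        ‖velocity f (s + (h : ℝ)) - velocity f s‖ₑ ^ (2 * p) * kernel Φ p (ℓ / 2) h := by
      filter_upwards [hae, hshift] with s hs hs'
      refine Tendsto.liminf_eq (ENNReal.Tendsto.mul_const ?_ (Or.inr hk))
      exact ((ENNReal.continuous_rpow_const).tendsto _).comp (hs'.sub hs).enorm
    calc _ = ∫⁻ s : AddCircle ℓ, ‖velocity f (s + (h : ℝ)) - velocity f s‖ₑ ^ (2 * p) *
          kernel Φ p (ℓ / 2) h :=
          (hmul (measurable_velocity f) h _).symm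
      _ = ∫⁻ s : AddCircle ℓ, liminf (fun n =>
          ‖diffQuot f (ν n) (s + (h : ℝ)) - diffQuot f (ν n) s‖ₑ ^ (2 * p) *
          kernel Φ p (ℓ / 2) h) atTop := (lintegral_congr_ae hlim).symm
      _ ≤ liminf (fun n => ∫⁻ s : AddCircle ℓ,
          ‖diffQuot f (ν n) (s + (h : ℝ)) - diffQuot f (ν n) s‖ₑ ^ (2 * p) *
          kernel Φ p (ℓ / 2) h) atTop :=
          lintegral_liminf_le fun n => (hsm (hgm n) h).mul_const _
      _ = _ := by
          simp only [hmul (hgm _)]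
  calc gagliardo Φ p (velocity f) ≤ ∫⁻ h, liminf (fun n =>
        increment (2 * p) (diffQuot f (ν n)) h * kernel Φ p (ℓ / 2) h) atTop := by
        refine lintegral_mono_ae ?_
        filter_upwards [Measure.ae_ne volume (0 : ℝ)] with h h0 using hfatou h h0
    _ ≤ liminf (fun n => gagliardo Φ p (diffQuot f (ν n))) atTop :=
        lintegral_liminf_le fun n => (measurable_increment (hgm n)).mul hKm
    _ ≤ B := liminf_le_of_frequently_le'
        (Eventually.frequently (Eventually.of_forall fun n => hB _ (hνpos n)))

end Limit

end OHara

end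

theorem theorem2p3 (p : ℝ) (hp : 1 ≤ p) (ℓ : ℝ) [Fact (0 < ℓ)] (Φ : ℝ → ℝ)
    (hΦ : OHara.IsAdmissible Φ p) :
    (∀ (d : ℕ) (f : AddCircle ℓ → EuclideanSpace ℝ (Fin d)),
      OHara.IsArcLengthClosedCurve f →
      OHara.MemW (OHara.psi Φ p) (2 * p) f →
      OHara.IsBiLipschitz f →
      OHara.energy Φ p f < ⊤) ∧
    (∃ C : ℝ, 0 < C ∧
      ∀ (d : ℕ) (f : AddCircle ℓ → EuclideanSpace ℝ (Fin d)),
        OHara.IsArcLengthClosedCurve f →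
        OHara.energy Φ p f < ⊤ →
        OHara.MemW (OHara.psi Φ p) (2 * p) f ∧
        ∀ f' : AddCircle ℓ → EuclideanSpace ℝ (Fin d),
          OHara.IsWeakDeriv f f' →
          OHara.wNorm (OHara.psi Φ p) (2 * p) f' ^ (2 * p) ≤
            ENNReal.ofReal C *
              (OHara.energy Φ p f + eLpNorm f' (ENNReal.ofReal (2 * p)) volume)) := by
  have hp0 : 0 < 2 * p := by linarith
  refine ⟨fun d f hf hW hbi => OHara.energy_lt_top hΦ hp hf hW hbi, ?_⟩
  obtain ⟨C₁, hC₁, hgag⟩ := OHara.exists_gagliardo_diffQuot_le hΦ hp ℓ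
  set C₂ : ℝ≥0∞ := (ENNReal.ofReal ℓ ^ (2 * p)⁻¹) ^ (2 * p - 1) with hC₂def
  have hC₂ : C₂ ≠ ⊤ := ENNReal.rpow_ne_top_of_nonneg (by linarith)
    (ENNReal.rpow_ne_top_of_nonneg (by positivity) ENNReal.ofReal_ne_top)
  set C₃ : ℝ≥0∞ := 2 ^ (2 * p - 1) * (C₁ + C₂) with hC₃def
  have hC₃ : C₃ ≠ ⊤ := ENNReal.mul_ne_top
    (ENNReal.rpow_ne_top_of_nonneg (by linarith) (by simp)) (ENNReal.add_ne_top.2 ⟨hC₁, hC₂⟩)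
  refine ⟨C₃.toReal + 1, by positivity, fun d f hf hE => ?_⟩
  have hgagv : OHara.gagliardo Φ p (OHara.velocity f) ≤ C₁ * OHara.energy Φ p f :=
    OHara.gagliardo_velocity_le hΦ (by linarith) hf fun ν hν => hgag hf hν
  have hweak := OHara.isWeakDeriv_velocity hf
  have hsemi := OHara.seminorm_rpow_eq_gagliardo hΦ hp (OHara.measurable_velocity f)
  obtain ⟨K, hK⟩ := hf.lipschitz
  refine ⟨⟨hK.continuous.memLp_of_hasCompactSupport (HasCompactSupport.of_compactSpace f),
    OHara.velocity f, hweak, ?_, ?_⟩, fun f' hf' => ?_⟩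
  · exact MemLp.of_bound (OHara.measurable_velocity f).aestronglyMeasurable 1
      (Eventually.of_forall (OHara.norm_velocity_le hf))
  · have : OHara.seminorm (OHara.psi Φ p) (2 * p) (OHara.velocity f) ^ (2 * p) < ⊤ := by
      rw [hsemi]
      exact hgagv.trans_lt (ENNReal.mul_lt_top hC₁.lt_top hE)
    exact (ENNReal.rpow_lt_top_iff_of_pos hp0).1 this
  · have hae := hf'.ae_eq hweak
    have hnorm := eLpNorm_congr_ae (p := ENNReal.ofReal (2 * p)) hae
    rw [OHara.wNorm, OHara.seminorm_congr_ae hae, hnorm]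
    set N := eLpNorm (OHara.velocity f) (ENNReal.ofReal (2 * p)) volume
    calc _ ≤ 2 ^ (2 * p - 1) * (N ^ (2 * p) +
          OHara.seminorm (OHara.psi Φ p) (2 * p) (OHara.velocity f) ^ (2 * p)) :=
          ENNReal.rpow_add_le_mul_rpow_add_rpow _ _ (by linarith)
      _ ≤ 2 ^ (2 * p - 1) * (C₂ * N + C₁ * OHara.energy Φ p f) := by
          rw [hsemi]
          gcongr
          exact OHara.eLpNorm_velocity_rpow_le hf (by linarith)
      _ ≤ 2 ^ (2 * p - 1) * ((C₁ + C₂) * N + (C₁ + C₂) * OHara.energy Φ p f) := by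
          gcongr
          · exact le_add_self
          · exact le_self_add
      _ = C₃ * (OHara.energy Φ p f + N) := by rw [hC₃def]; ring
      _ ≤ _ := by
          gcongr
          exact (ENNReal.ofReal_toReal hC₃).symm.le.trans
            (ENNReal.ofReal_le_ofReal (by linarith))
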